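/- Let $\Gamma$ be a countable directed graph with vertex set $\Gamma_V$ and arrow set $\Gamma_{Ar}$ (loops and multiple arrows allowed), where an arrow $a$ has source $s(a)$ and range $r(a)$. Finite paths may have length $0$. Assume that $\Gamma$ is - row-finite: every vertex emits only finitely many arrows; - strongly connected: for all vertices $v,w$ there is a finite path from $v$ to $w$; - almost undirected: there is $N\in\mathbb N$ such that for every arrow $a$ there is a finite path of length at most $N$ from $r(a)$ to $s(a)$. Let $F:\Gamma_{Ar}\to\mathbb R$ be a function, let $\beta\in\mathbb R$, and put $A(\beta)_{v,w}=\sum_{a:\,s(a)=v,\ r(a)=w}e^{-\beta F(a)}$ for $v,w\in\Gamma_V$. Assume that $A(\beta)$ is transient, i.e. $\sum_{n=0}^\infty A(\beta)^n_{v,v}<\infty$ for all $v\in\Gamma_V$. Let $P(\Gamma)$ be the space of infinite paths $p=(p_i)_{i\ge1}$, with the topology inherited from the product $\Gamma_{Ar}^{\mathbb N}$ of discrete spaces, let $\sigma(p)_i=p_{i+1}$, and let $Z(v)$ and $Z(a)$ be the sets of infinite paths starting at the vertex $v$ and with the arrow $a$, respectively. A non-zero Borel measure $m$ on $P(\Gamma)$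 with $m(Z(v))<\infty$ for all $v$ is $e^{\beta F}$-conformal if $m(\sigma(B\cap Z(a)))=e^{\beta F(a)}m(B\cap Z(a))$ for all arrows $a$ and all Borel sets $B\subseteq P(\Gamma)$. It is extremal if every $e^{\beta F}$-conformal measure $m'\le m$ is of the form $m'=\lambda m$ with $\lambda>0$. A path $p\in P(\Gamma)$ is wandering if for every finite $K\subseteq\Gamma_V$ one has $s(p_i)\notin K$ for all large $i$. For wandering paths $p,q$ write $p\to q$ if for every finite $K\subseteq\Gamma_V$ and every $N\in\mathbb N$ there are $n_1,n_2\ge N$ and a finite path from $s(p_{n_1})$ to $s(q_{n_2})$ none of whose vertices is in $K$. The end space $\mathcal E(\Gamma)$ is the set of equivalence classes of wandering paths under the relation "$p\to q$ and $q\to p$". A measure $m$ is concentrated on $E\in\mathcal E(\Gamma)$ if $m(P(\Gamma)\setminus E)=0$. Then every extremal $e^{\beta F}$-conformal measure is concentrated on exactly one end, and the resulting map from the set of extremal $e^{\beta F}$-conformal measures to $\mathcal E(\Gamma)$ is surjective. -/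

import Mathlib

open MeasureTheory
open scoped ENNReal NNReal

/-- A directed graph with vertex set `V` and arrow set `A` (loops and multiple arrows are allowed);
`s a` is the source and `r a` the range of the arrow `a`. -/
structure DirGraph (V A : Type*) where
  s : A → V
  r : A → V

namespace DirGraph

variable {V A : Type*} (Γ : DirGraph V A)

/-- `Γ.IsPath v μ w`: the list of arrows `μ` is a finite path from `v` to `w`; the empty list is
the path of length `0` at a vertex. The length of the path is `μ.length`. -/
def IsPath : V → List A → V → Prop
  | v, [], w => v = w
  | v, a :: μ, w => Γ.s a = v ∧ IsPath (Γ.r a) μ w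

/-- All vertices occurring in the finite path `μ` starting at `v`. -/
def pathVertices (v : V) (μ : List A) : List V := v :: μ.map Γ.r

/-- Every vertex emits only finitely many arrows. -/
def RowFinite : Prop := ∀ v : V, {a : A | Γ.s a = v}.Finite

def StronglyConnected : Prop := ∀ v w : V, ∃ μ : List A, Γ.IsPath v μ w

/-- There is a uniform bound on the length of a shortest path from the range of an arrow back to
its source. -/
def AlmostUndirected : Prop :=
  ∃ N : ℕ, ∀ a : A, ∃ μ : List A, μ.length ≤ N ∧ Γ.IsPath (Γ.r a) μ (Γ.s a)

/-! ### The matrix `A(β)` -/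

/-- `A(β)_{v,w} = ∑ e^{-β F(a)}`, the sum over all arrows `a` from `v` to `w`. -/
noncomputable def weightMatrix (F : A → ℝ) (β : ℝ) (v w : V) : ℝ≥0∞ :=
  ∑' a : {a : A // Γ.s a = v ∧ Γ.r a = w}, ENNReal.ofReal (Real.exp (-(β * F a)))

open Classical in
/-- The entries of the powers `A(β)^n`. -/
noncomputable def weightMatrixPow (F : A → ℝ) (β : ℝ) : ℕ → V → V → ℝ≥0∞
  | 0, v, w => if v = w then 1 else 0
  | n + 1, v, w => ∑' u : V, Γ.weightMatrix F β v u * weightMatrixPow F β n u w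

def Recurrent (F : A → ℝ) (β : ℝ) : Prop :=
  ∃ v : V, ∑' n : ℕ, Γ.weightMatrixPow F β n v v = ∞

def Transient (F : A → ℝ) (β : ℝ) : Prop := ¬ Γ.Recurrent F β

/-! ### The space of infinite paths and conformal measures -/

/-- The set `P(Γ)` of infinite paths. -/
def InfPath : Type _ := {p : ℕ → A // ∀ i, Γ.r (p i) = Γ.s (p (i + 1))}

/-- The topology inherited from the product of copies of the discrete space of arrows. -/
instance : TopologicalSpace Γ.InfPath :=
  TopologicalSpace.induced (fun p => p.1) (@Pi.topologicalSpace ℕ (fun _ => A) (fun _ => ⊥))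

instance : MeasurableSpace Γ.InfPath := borel Γ.InfPath

instance : BorelSpace Γ.InfPath := ⟨rfl⟩

variable {Γ} in
/-- The vertex visited by an infinite path at time `i`. -/
def InfPath.vertex (p : Γ.InfPath) (i : ℕ) : V := Γ.s (p.1 i)

/-- The shift map on the space of infinite paths. -/
def shift (p : Γ.InfPath) : Γ.InfPath := ⟨fun i => p.1 (i + 1), fun i => p.2 (i + 1)⟩

/-- The cylinder `Z(v)` of infinite paths that start at the vertex `v`. -/
def vertexCylinder (v : V) : Set Γ.InfPath := {p | p.vertex 0 = v}

/-- The cylinder `Z(a)` of infinite paths whose first arrow is `a`. -/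
def arrowCylinder (a : A) : Set Γ.InfPath := {p | p.1 0 = a}

/-- `m` is an `e^{βF}`-conformal measure: a non-zero Borel measure on `P(Γ)`, finite on each
`Z(v)`, with `m(σ(B ∩ Z(a))) = e^{βF(a)} m(B ∩ Z(a))`. -/
structure IsConformal (F : A → ℝ) (β : ℝ) (m : Measure Γ.InfPath) : Prop where
  ne_zero : m ≠ 0
  regular : ∀ v : V, m (Γ.vertexCylinder v) < ∞
  conformal : ∀ (a : A) (B : Set Γ.InfPath), MeasurableSet B →
    m (Γ.shift '' (B ∩ Γ.arrowCylinder a)) =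
      ENNReal.ofReal (Real.exp (β * F a)) * m (B ∩ Γ.arrowCylinder a)

/-- A conformal measure is extremal when it only dominates conformal measures that are
multiples of itself. -/
structure IsExtremalConformal (F : A → ℝ) (β : ℝ) (m : Measure Γ.InfPath) : Prop where
  isConformal : Γ.IsConformal F β m
  extremal : ∀ m' : Measure Γ.InfPath, Γ.IsConformal F β m' → m' ≤ m →
    ∃ c : ℝ≥0, 0 < c ∧ m' = c • m

/-! ### The end space -/

variable {Γ} in
/-- An infinite path is wandering when it eventually leaves every finite set of vertices. -/
def InfPath.IsWandering (p : Γ.InfPath) : Prop :=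
  ∀ K : Finset V, ∃ N : ℕ, ∀ i ≥ N, p.vertex i ∉ K

/-- The set `Wan(Γ)` of wandering paths. -/
abbrev Wan : Type _ := {p : Γ.InfPath // p.IsWandering}

/-- The relation `p → q`: outside of any finite set of vertices there are finite paths from
arbitrarily late vertices of `p` to arbitrarily late vertices of `q`. -/
def Leads (p q : Γ.Wan) : Prop :=
  ∀ (K : Finset V) (N : ℕ), ∃ n₁ ≥ N, ∃ n₂ ≥ N, ∃ μ : List A,
    Γ.IsPath (p.1.vertex n₁) μ (q.1.vertex n₂) ∧
      ∀ u ∈ Γ.pathVertices (p.1.vertex n₁) μ, u ∉ K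

theorem IsPath.append {u v w : V} {μ ν : List A} (h₁ : Γ.IsPath u μ v) (h₂ : Γ.IsPath v ν w) :
    Γ.IsPath u (μ ++ ν) w := by
  induction μ generalizing u with
  | nil => cases h₁; exact h₂
  | cons a μ ih => exact ⟨h₁.1, ih h₁.2⟩

theorem exists_path_along (p : Γ.InfPath) (K : Finset V) (n k : ℕ)
    (hK : ∀ i ≥ n, p.vertex i ∉ K) :
    ∃ μ : List A, Γ.IsPath (p.vertex n) μ (p.vertex (n + k)) ∧
      ∀ u ∈ μ.map Γ.r, u ∉ K := by
  induction k with
  | zero => exact ⟨[], rfl, by simp⟩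
  | succ k ih =>
    obtain ⟨μ, h₁, h₂⟩ := ih
    refine ⟨μ ++ [p.1 (n + k)], IsPath.append Γ h₁ ⟨rfl, p.2 (n + k)⟩, ?_⟩
    intro u hu
    rw [List.map_append, List.mem_append] at hu
    rcases hu with hu | hu
    · exact h₂ u hu
    · have hu' : u = p.vertex (n + k + 1) := by
        rw [List.map_cons, List.map_nil, List.mem_singleton] at hu
        rw [hu]; exact p.2 (n + k)
      rw [hu']
      exact hK _ (by omega)

theorem Leads.refl (p : Γ.Wan) : Γ.Leads p p := by
  intro K N
  obtain ⟨M, hM⟩ := p.2 K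
  refine ⟨max N M, le_max_left _ _, max N M, le_max_left _ _, [], rfl, ?_⟩
  intro u hu
  rw [pathVertices, List.map_nil, List.mem_singleton] at hu
  rw [hu]
  exact hM _ (le_max_right _ _)

theorem Leads.trans {p q t : Γ.Wan} (h₁ : Γ.Leads p q) (h₂ : Γ.Leads q t) : Γ.Leads p t := by
  intro K N
  obtain ⟨M, hM⟩ := q.2 K
  obtain ⟨n₁, hn₁, n₂, hn₂, μ, hμ, hμK⟩ := h₁ K (max N M)
  obtain ⟨n₃, hn₃, n₄, hn₄, ν, hν, hνK⟩ := h₂ K (max N n₂)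
  obtain ⟨l, hl⟩ := Nat.exists_eq_add_of_le (le_trans (le_max_right N n₂) hn₃)
  obtain ⟨ξ, hξ, hξK⟩ := Γ.exists_path_along q.1 K n₂ l
    (fun i hi => hM i (le_trans (le_trans (le_max_right N M) hn₂) hi))
  rw [← hl] at hξ
  refine ⟨n₁, le_trans (le_max_left _ _) hn₁, n₄, le_trans (le_max_left _ _) hn₄,
    (μ ++ ξ) ++ ν, IsPath.append Γ (IsPath.append Γ hμ hξ) hν, ?_⟩
  intro u hu
  simp only [pathVertices, List.mem_cons, List.map_append, List.mem_append] at hu hμK hνK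
  rcases hu with hu | (hu | hu) | hu
  · exact hμK u (Or.inl hu)
  · exact hμK u (Or.inr hu)
  · exact hξK u hu
  · exact hνK u (Or.inr hu)

/-- The equivalence relation on wandering paths: `p → q` and `q → p`. -/
def wanSetoid : Setoid Γ.Wan where
  r p q := Γ.Leads p q ∧ Γ.Leads q p
  iseqv :=
    { refl := fun p => ⟨Leads.refl Γ p, Leads.refl Γ p⟩
      symm := fun h => ⟨h.2, h.1⟩
      trans := fun h₁ h₂ => ⟨Leads.trans Γ h₁.1 h₂.1, Leads.trans Γ h₂.2 h₁.2⟩ }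

/-- The end space of `Γ`. -/
def EndSpace : Type _ := Quotient Γ.wanSetoid

variable {Γ} in
/-- An end as a subset of `P(Γ)`: the wandering paths that belong to the equivalence class. -/
def EndSpace.carrier (E : Γ.EndSpace) : Set Γ.InfPath :=
  {p | ∃ h : p.IsWandering, Quotient.mk Γ.wanSetoid ⟨p, h⟩ = E}

/-- The measure `m` is concentrated on the end `E`. -/
def ConcentratedOn (m : Measure Γ.InfPath) (E : Γ.EndSpace) : Prop := m E.carrierᶜ = 0

end DirGraph

namespace DirGraph

variable {V A : Type*} (Γ : DirGraph V A)

/-! ### Finite paths avoiding a finite set of vertices -/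

/-- The finite set of arrows emitted by the vertex `v`. -/
noncomputable def outArrows {Γ : DirGraph V A} (hrow : Γ.RowFinite) (v : V) : Finset A :=
  (hrow v).toFinset

@[simp]
theorem mem_outArrows {Γ : DirGraph V A} (hrow : Γ.RowFinite) {v : V} {a : A} :
    a ∈ outArrows hrow v ↔ Γ.s a = v := by
  simp [outArrows]

/-- There is a finite path from `v` to `w` none of whose vertices is in `K`. -/
def ReachAvoiding (K : Finset V) (v w : V) : Prop :=
  ∃ μ : List A, Γ.IsPath v μ w ∧ ∀ u ∈ Γ.pathVertices v μ, u ∉ K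

variable {Γ}

theorem ReachAvoiding.refl {K : Finset V} {v : V} (hv : v ∉ K) : Γ.ReachAvoiding K v v :=
  ⟨[], rfl, by simpa [pathVertices] using hv⟩

theorem ReachAvoiding.cons {K : Finset V} {a : A} {w : V} (ha : Γ.s a ∉ K)
    (h : Γ.ReachAvoiding K (Γ.r a) w) : Γ.ReachAvoiding K (Γ.s a) w := by
  obtain ⟨μ, hμ, hK⟩ := h
  refine ⟨a :: μ, ⟨rfl, hμ⟩, ?_⟩
  rintro u (_ | ⟨_, hu⟩)
  · exact ha
  · exact hK u hu

theorem ReachAvoiding.trans {K : Finset V} {u v w : V} (h₁ : Γ.ReachAvoiding K u v)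
    (h₂ : Γ.ReachAvoiding K v w) : Γ.ReachAvoiding K u w := by
  obtain ⟨μ, hμ, hK⟩ := h₁
  induction μ generalizing u with
  | nil => cases hμ; exact h₂
  | cons a μ ih =>
    obtain ⟨rfl, hμ⟩ := hμ
    exact .cons (hK _ (by simp [pathVertices]))
      (ih hμ fun x hx => hK x (List.mem_cons_of_mem _ hx))

theorem ReachAvoiding.along (p : Γ.InfPath) {K : Finset V} {n m : ℕ} (hnm : n ≤ m)
    (hK : ∀ i ≥ n, p.vertex i ∉ K) : Γ.ReachAvoiding K (p.vertex n) (p.vertex m) := by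
  obtain ⟨k, rfl⟩ := Nat.exists_eq_add_of_le hnm
  obtain ⟨μ, h₁, h₂⟩ := Γ.exists_path_along p K n k hK
  refine ⟨μ, h₁, ?_⟩
  rintro u (_ | ⟨_, hu⟩)
  · exact hK n le_rfl
  · exact h₂ u hu

open Classical in
/-- The vertices that can be reached from `K` by a path of length at most `n`. -/
noncomputable def outBall (hrow : Γ.RowFinite) (K : Finset V) : ℕ → Finset V
  | 0 => K
  | n + 1 => outBall hrow K n ∪
      (outBall hrow K n).biUnion fun v => (outArrows hrow v).image Γ.r

theorem outBall_mono (hrow : Γ.RowFinite) (K : Finset V) : Monotone (outBall hrow K) :=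
  monotone_nat_of_le_succ fun n => by
    classical
    rw [outBall]
    exact Finset.subset_union_left

theorem mem_outBall_add (hrow : Γ.RowFinite) {K : Finset V} {v w : V} {μ : List A} {n : ℕ}
    (hv : v ∈ outBall hrow K n) (hμ : Γ.IsPath v μ w) : w ∈ outBall hrow K (n + μ.length) := by
  induction μ generalizing v n with
  | nil => cases hμ; exact hv
  | cons a μ ih =>
    obtain ⟨rfl, hμ⟩ := hμ
    have h : Γ.r a ∈ outBall hrow K (n + 1) := by
      classical
      rw [outBall, Finset.mem_union]
      refine Or.inr (Finset.mem_biUnion.2 ⟨_, hv, Finset.mem_image_of_mem _ ?_⟩)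
      simp
    have := ih h hμ
    rwa [List.length_cons, add_comm μ.length, ← add_assoc]

theorem IsPath.exists_prefix {v w u : V} {μ : List A} (hμ : Γ.IsPath v μ w)
    (hu : u ∈ Γ.pathVertices v μ) : ∃ ν : List A, ν.length ≤ μ.length ∧ Γ.IsPath v ν u := by
  induction μ generalizing v with
  | nil =>
    have : u = v := by simpa [pathVertices] using hu
    exact ⟨[], le_rfl, this.symm⟩
  | cons a μ ih =>
    obtain ⟨rfl, hμ⟩ := hμ
    rcases hu with _ | ⟨_, hu⟩
    · exact ⟨[], Nat.zero_le _, rfl⟩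
    · obtain ⟨ν, hν, h⟩ := ih hμ hu
      exact ⟨a :: ν, by simpa using hν, rfl, h⟩

theorem IsPath.exists_reverse {N : ℕ}
    (hN : ∀ a : A, ∃ μ : List A, μ.length ≤ N ∧ Γ.IsPath (Γ.r a) μ (Γ.s a)) {v w : V}
    {μ : List A} (hμ : Γ.IsPath v μ w) :
    ∃ ν : List A, ν.length ≤ N * μ.length ∧ Γ.IsPath w ν v := by
  induction μ generalizing v with
  | nil => exact ⟨[], Nat.zero_le _, hμ.symm⟩
  | cons a μ ih =>
    obtain ⟨rfl, hμ⟩ := hμ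
    obtain ⟨ν, hν, h⟩ := ih hμ
    obtain ⟨ξ, hξ, h'⟩ := hN a
    refine ⟨ν ++ ξ, ?_, IsPath.append Γ h h'⟩
    simp only [List.length_append, List.length_cons, mul_add, mul_one]
    omega

/-- In a row-finite almost undirected graph, every arrow that ends outside of a sufficiently large
finite set can be traversed backwards while avoiding a given finite set. -/
theorem exists_finset_return (hrow : Γ.RowFinite) (hund : Γ.AlmostUndirected) (K : Finset V) :
    ∃ K' : Finset V, K ⊆ K' ∧ ∀ a : A, Γ.r a ∉ K' → Γ.ReachAvoiding K (Γ.r a) (Γ.s a) := by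
  obtain ⟨N, hN⟩ := hund
  refine ⟨outBall hrow K (N * N), outBall_mono hrow K (Nat.zero_le _), fun a ha => ?_⟩
  obtain ⟨μ, hμN, hμ⟩ := hN a
  refine ⟨μ, hμ, fun u hu huK => ha ?_⟩
  obtain ⟨ν, hν, hp⟩ := hμ.exists_prefix hu
  obtain ⟨ξ, hξ, hp'⟩ := hp.exists_reverse hN
  have h₀ : u ∈ outBall hrow K 0 := huK
  refine outBall_mono hrow K ?_ (mem_outBall_add hrow h₀ hp')
  rw [zero_add]
  exact hξ.trans (Nat.mul_le_mul_left N (hν.trans hμN))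

theorem ReachAvoiding.reverse {K K' : Finset V} (hKK' : K ⊆ K')
    (hK' : ∀ a : A, Γ.r a ∉ K' → Γ.ReachAvoiding K (Γ.r a) (Γ.s a)) {v w : V}
    (h : Γ.ReachAvoiding K' v w) : Γ.ReachAvoiding K w v := by
  obtain ⟨μ, hμ, hav⟩ := h
  induction μ generalizing v with
  | nil =>
    cases hμ
    exact .refl fun hK => hav w (by simp [pathVertices]) (hKK' hK)
  | cons a μ ih =>
    obtain ⟨rfl, hμ⟩ := hμ
    have hav' : ∀ u ∈ Γ.pathVertices (Γ.r a) μ, u ∉ K' :=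
      fun x hx => hav x (List.mem_cons_of_mem _ hx)
    exact (ih hμ hav').trans (hK' a (hav' _ (by simp [pathVertices])))

theorem Leads.symm (hrow : Γ.RowFinite) (hund : Γ.AlmostUndirected) {p q : Γ.Wan}
    (h : Γ.Leads p q) : Γ.Leads q p := by
  intro K N
  obtain ⟨K', hKK', hK'⟩ := exists_finset_return hrow hund K
  obtain ⟨n₁, hn₁, n₂, hn₂, h⟩ := h K' N
  exact ⟨n₂, hn₂, n₁, hn₁, ReachAvoiding.reverse hKK' hK' h⟩

section Potential

/-! ### Potential theory of the weighted graph -/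

/-- The weight `e^{-βF(a)}` of an arrow. -/
noncomputable def weight (F : A → ℝ) (β : ℝ) (a : A) : ℝ≥0 := Real.toNNReal (Real.exp (-(β * F a)))

theorem weight_pos (F : A → ℝ) (β : ℝ) (a : A) : 0 < weight F β a :=
  Real.toNNReal_pos.2 (Real.exp_pos _)

theorem ofReal_exp_mul_weight (F : A → ℝ) (β : ℝ) (a : A) :
    ENNReal.ofReal (Real.exp (β * F a)) * weight F β a = 1 := by
  change _ * ENNReal.ofReal _ = 1
  rw [← ENNReal.ofReal_mul (Real.exp_pos _).le, ← Real.exp_add]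
  simp

open Classical in
/-- The action of the matrix with entries `1_D(v) ∑ w(a)`, the sum over all arrows `a` from `v`
to `u`, on functions on the vertices. -/
noncomputable def step (hrow : Γ.RowFinite) (w : A → ℝ≥0) (D : Set V) :
    Module.End ℝ≥0∞ (V → ℝ≥0∞) where
  toFun f v := if v ∈ D then ∑ a ∈ outArrows hrow v, (w a : ℝ≥0∞) * f (Γ.r a) else 0
  map_add' f g := by
    ext v
    by_cases hv : v ∈ D <;> simp [hv, mul_add, Finset.sum_add_distrib]
  map_smul' c f := by
    ext v
    by_cases hv : v ∈ D <;> simp [hv, Finset.mul_sum, mul_left_comm]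

variable (hrow : Γ.RowFinite) (w : A → ℝ≥0)

theorem step_apply_of_mem {D : Set V} {v : V} (hv : v ∈ D) (f : V → ℝ≥0∞) :
    step hrow w D f v = ∑ a ∈ outArrows hrow v, (w a : ℝ≥0∞) * f (Γ.r a) := by
  simp [step, hv]

theorem step_apply_of_notMem {D : Set V} {v : V} (hv : v ∉ D) (f : V → ℝ≥0∞) :
    step hrow w D f v = 0 := by
  simp [step, hv]

theorem step_univ_apply (f : V → ℝ≥0∞) (v : V) :
    step hrow w Set.univ f v = ∑ a ∈ outArrows hrow v, (w a : ℝ≥0∞) * f (Γ.r a) :=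
  step_apply_of_mem hrow w (Set.mem_univ v) f

theorem step_le_step_univ (D : Set V) {f g : V → ℝ≥0∞} (hfg : f ≤ g) :
    step hrow w D f ≤ step hrow w Set.univ g := by
  intro v
  rw [step_univ_apply]
  by_cases hv : v ∈ D
  · rw [step_apply_of_mem hrow w hv]
    gcongr
    exact hfg _
  · rw [step_apply_of_notMem hrow w hv]
    exact zero_le

theorem step_pow_le_step_univ_pow (D : Set V) (n : ℕ) (f : V → ℝ≥0∞) :
    (step hrow w D ^ n) f ≤ (step hrow w Set.univ ^ n) f := by
  induction n with
  | zero => exact le_rfl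
  | succ n ih =>
    rw [pow_succ', pow_succ']
    exact step_le_step_univ hrow w D ih

open Classical in
/-- The total weight of paths from `v` to `x` all of whose vertices but the last are
in `D`. -/
noncomputable def green (D : Set V) (x v : V) : ℝ≥0∞ :=
  ∑' n : ℕ, (step hrow w D ^ n) (Pi.single x 1) v

theorem green_le_green_univ (D : Set V) (x v : V) :
    green hrow w D x v ≤ green hrow w Set.univ x v :=
  ENNReal.tsum_le_tsum fun n => step_pow_le_step_univ_pow hrow w D n _ v

open Classical in
theorem green_univ_eq (x : V) :
    green hrow w Set.univ x = Pi.single x 1 + step hrow w Set.univ (green hrow w Set.univ x) := by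
  ext v
  rw [Pi.add_apply, step_univ_apply, green, tsum_eq_zero_add' ENNReal.summable]
  congr 1
  simp only [green, ← ENNReal.tsum_mul_left]
  rw [← Summable.tsum_finsetSum fun _ _ => ENNReal.summable]
  refine tsum_congr fun n => ?_
  rw [pow_succ', Module.End.mul_apply, step_univ_apply]

theorem step_green_univ_le (x : V) :
    step hrow w Set.univ (green hrow w Set.univ x) ≤ green hrow w Set.univ x := by
  conv_rhs => rw [green_univ_eq]
  exact le_add_self

theorem green_univ_eq_step {x v : V} (hv : v ≠ x) :
    green hrow w Set.univ x v = step hrow w Set.univ (green hrow w Set.univ x) v := by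
  conv_lhs => rw [green_univ_eq]
  simp [hv]

theorem one_le_green_univ_self (x : V) : 1 ≤ green hrow w Set.univ x x := by
  rw [green_univ_eq]
  simp

theorem step_univ_pow_green_apply (n : ℕ) (x v : V) [DecidableEq V] :
    (step hrow w Set.univ ^ n) (green hrow w Set.univ x) v =
      ∑' k : ℕ, (step hrow w Set.univ ^ (k + n)) (Pi.single x 1) v := by
  induction n generalizing v with
  | zero =>
    simp only [add_zero, pow_zero, Module.End.one_apply, green]
    congr!
  | succ n ih =>
    rw [pow_succ', Module.End.mul_apply, step_univ_apply]
    simp only [ih, ← ENNReal.tsum_mul_left]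
    rw [← Summable.tsum_finsetSum fun _ _ => ENNReal.summable]
    refine tsum_congr fun k => ?_
    rw [← add_assoc, pow_succ', Module.End.mul_apply, step_univ_apply]

/-- Positivity of superharmonic functions spreads along paths. -/
theorem harnack (hconn : Γ.StronglyConnected) (hw : ∀ a, 0 < w a) (v u : V) :
    ∃ c : ℝ≥0, 0 < c ∧ ∀ f : V → ℝ≥0∞, step hrow w Set.univ f ≤ f → c * f u ≤ f v := by
  obtain ⟨μ, hμ⟩ := hconn v u
  induction μ generalizing v with
  | nil => cases hμ; exact ⟨1, one_pos, fun f _ => by simp⟩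
  | cons a μ ih =>
    obtain ⟨rfl, hμ⟩ := hμ
    obtain ⟨c, hc, h⟩ := ih _ hμ
    refine ⟨w a * c, mul_pos (hw a) hc, fun f hf => ?_⟩
    calc ((w a * c : ℝ≥0) : ℝ≥0∞) * f u = w a * (c * f u) := by push_cast; ring
      _ ≤ w a * f (Γ.r a) := by gcongr; exact h f hf
      _ ≤ ∑ b ∈ outArrows hrow (Γ.s a), (w b : ℝ≥0∞) * f (Γ.r b) :=
          Finset.single_le_sum (f := fun b => (w b : ℝ≥0∞) * f (Γ.r b))
            (fun _ _ => zero_le) (by simp)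
      _ ≤ f (Γ.s a) := by rw [← step_univ_apply hrow w]; exact hf _

theorem green_univ_ne_top (hconn : Γ.StronglyConnected) (hw : ∀ a, 0 < w a)
    (hfin : ∀ v, green hrow w Set.univ v v ≠ ∞) (x v : V) : green hrow w Set.univ x v ≠ ∞ := by
  obtain ⟨c, hc, h⟩ := harnack hrow w hconn hw x v
  intro htop
  have := h _ (step_green_univ_le hrow w x)
  rw [htop, ENNReal.mul_top (by simpa using hc.ne')] at this
  exact hfin x (top_le_iff.1 this)

theorem green_univ_ne_zero (hconn : Γ.StronglyConnected) (hw : ∀ a, 0 < w a) (x v : V) :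
    green hrow w Set.univ x v ≠ 0 := by
  obtain ⟨c, hc, h⟩ := harnack hrow w hconn hw v x
  have := h _ (step_green_univ_le hrow w x)
  intro h0
  rw [h0, nonpos_iff_eq_zero, mul_eq_zero] at this
  rcases this with h1 | h1
  · simp [hc.ne'] at h1
  · simpa [h1] using one_le_green_univ_self hrow w x

theorem step_pow_congr {D : Set V} {K : Finset V}
    (hDK : ∀ a, Γ.s a ∈ D → Γ.r a ∈ D ∨ Γ.r a ∈ K) {f g : V → ℝ≥0∞}
    (hfg : ∀ v, v ∈ D ∨ v ∈ K → f v = g v) (n : ℕ) {v : V} (hv : v ∈ D ∨ v ∈ K) :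
    (step hrow w D ^ n) f v = (step hrow w D ^ n) g v := by
  induction n generalizing v with
  | zero => exact hfg v hv
  | succ n ih =>
    simp only [pow_succ', Module.End.mul_apply]
    by_cases hvD : v ∈ D
    · simp only [step_apply_of_mem hrow w hvD]
      refine Finset.sum_congr rfl fun a ha => ?_
      rw [mem_outArrows] at ha
      rw [ih (hDK a (ha ▸ hvD))]
    · simp only [step_apply_of_notMem hrow w hvD]

open Classical in
theorem eq_sum_step_pow_add {D : Set V} {f : V → ℝ≥0∞}
    (hf : ∀ v ∈ D, f v = step hrow w Set.univ f v) (n : ℕ) :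
    f = ∑ j ∈ Finset.range n, (step hrow w D ^ j) (Dᶜ.indicator f) + (step hrow w D ^ n) f := by
  have h1 : f = Dᶜ.indicator f + step hrow w D f := by
    ext v
    by_cases hv : v ∈ D
    · rw [Pi.add_apply, step_apply_of_mem hrow w hv, ← step_univ_apply hrow w, ← hf v hv]
      simp [hv]
    · rw [Pi.add_apply, step_apply_of_notMem hrow w hv]
      simp [hv]
  induction n with
  | zero => simp
  | succ n ih =>
    conv_lhs => rw [ih]
    rw [Finset.sum_range_succ, add_assoc]
    congr 1
    conv_lhs => rw [h1]
    rw [map_add, pow_succ, Module.End.mul_apply]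

open Classical in
/-- First exit decomposition of a function that is harmonic on `D`, when the arrows that leave
`D` end in `K`. -/
theorem eq_sum_exit_add {D : Set V} {K : Finset V} (hK : ∀ k ∈ K, k ∉ D)
    (hDK : ∀ a, Γ.s a ∈ D → Γ.r a ∈ D ∨ Γ.r a ∈ K) {f : V → ℝ≥0∞}
    (hf : ∀ v ∈ D, f v = step hrow w Set.univ f v) (n : ℕ) {v : V} (hv : v ∈ D) :
    f v = ∑ k ∈ K, (∑ j ∈ Finset.range n, (step hrow w D ^ j) (Pi.single k 1) v) * f k +
      (step hrow w D ^ n) f v := by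
  conv_lhs => rw [eq_sum_step_pow_add hrow w hf n]
  rw [Pi.add_apply, Finset.sum_apply]
  congr 1
  simp only [Finset.sum_mul]
  rw [Finset.sum_comm]
  refine Finset.sum_congr rfl fun j _ => ?_
  rw [step_pow_congr hrow w hDK (g := ∑ k ∈ K, f k • Pi.single k 1) ?_ j (Or.inl hv)]
  · simp [map_sum, Finset.sum_apply, mul_comm]
  · intro u hu
    rw [Finset.sum_apply]
    by_cases huK : u ∈ K
    · simp [hK u huK, Pi.single_apply, huK]
    · have huD := hu.resolve_right huK
      simp [Pi.single_apply, huK, huD]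

theorem tendsto_sum_exit (D : Set V) (K : Finset V) {f : V → ℝ≥0∞} (hf : ∀ v, f v ≠ ∞) (v : V)
    [DecidableEq V] :
    Filter.Tendsto (fun n : ℕ =>
      ∑ k ∈ K, (∑ j ∈ Finset.range n, (step hrow w D ^ j) (Pi.single k 1) v) * f k)
      Filter.atTop (nhds (∑ k ∈ K, green hrow w D k v * f k)) := by
  refine tendsto_finsetSum _ fun k _ => ENNReal.Tendsto.mul_const ?_ (Or.inr (hf k))
  have := ENNReal.tendsto_nat_tsum fun j => (step hrow w D ^ j) (Pi.single k 1) v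
  convert this
  rw [green]
  congr!

theorem green_univ_eq_sum_exit {D : Set V} {K : Finset V} (hK : ∀ k ∈ K, k ∉ D)
    (hDK : ∀ a, Γ.s a ∈ D → Γ.r a ∈ D ∨ Γ.r a ∈ K) {x : V} (hx : x ∉ D)
    (hfin : ∀ v, green hrow w Set.univ x v ≠ ∞) {v : V} (hv : v ∈ D) :
    green hrow w Set.univ x v = ∑ k ∈ K, green hrow w D k v * green hrow w Set.univ x k := by
  classical
  have h1 : ∀ u ∈ D, green hrow w Set.univ x u =
      step hrow w Set.univ (green hrow w Set.univ x) u := fun u hu =>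
    green_univ_eq_step hrow w fun h => hx (h ▸ hu)
  have h2 : Filter.Tendsto (fun n => (step hrow w D ^ n) (green hrow w Set.univ x) v)
      Filter.atTop (nhds 0) := by
    have hsum := hfin v
    rw [green] at hsum
    refine tendsto_of_tendsto_of_tendsto_of_le_of_le tendsto_const_nhds
      (ENNReal.tendsto_sum_nat_add _ hsum) (fun _ => zero_le) fun n => ?_
    refine (step_pow_le_step_univ_pow hrow w D n _ v).trans ?_
    rw [step_univ_pow_green_apply]
  have h3 := (tendsto_sum_exit hrow w D K hfin v).add h2
  rw [add_zero] at h3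
  refine tendsto_nhds_unique (tendsto_const_nhds.congr fun n => ?_) h3
  exact eq_sum_exit_add hrow w hK hDK h1 n hv

theorem tsum_weightMatrix_mul (F : A → ℝ) (β : ℝ) (f : V → ℝ≥0∞) (v : V) :
    ∑' u, Γ.weightMatrix F β v u * f u = step hrow (weight F β) Set.univ f v := by
  classical
  have h1 : ∀ u, Γ.weightMatrix F β v u * f u = ∑ a ∈ outArrows hrow v,
      if Γ.r a = u then (weight F β a : ℝ≥0∞) * f u else 0 := by
    intro u
    have hmem : ∀ a, a ∈ (outArrows hrow v).filter (fun a => Γ.r a = u) ↔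
        Γ.s a = v ∧ Γ.r a = u := by simp
    rw [weightMatrix, ← Finset.sum_filter, ← Finset.sum_mul]
    congr 1
    rw [← Finset.tsum_subtype]
    exact (Equiv.subtypeEquivRight hmem).symm.tsum_eq
      (fun a : {a // a ∈ (outArrows hrow v).filter (fun a => Γ.r a = u)} =>
        (weight F β a : ℝ≥0∞))
  rw [tsum_congr h1, Summable.tsum_finsetSum fun _ _ => ENNReal.summable, step_univ_apply]
  refine Finset.sum_congr rfl fun a _ => ?_
  rw [tsum_eq_single (Γ.r a)]
  · simp
  · intro u hu
    simp [hu.symm]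

open Classical in
theorem weightMatrixPow_eq (F : A → ℝ) (β : ℝ) (n : ℕ) (v u : V) :
    Γ.weightMatrixPow F β n v u =
      (step hrow (weight F β) Set.univ ^ n) (Pi.single u 1) v := by
  induction n generalizing v with
  | zero => simp [weightMatrixPow, Pi.single_apply]
  | succ n ih =>
    rw [weightMatrixPow, tsum_weightMatrix_mul hrow F β fun x => Γ.weightMatrixPow F β n x u,
      pow_succ', Module.End.mul_apply]
    exact congrArg (fun g => step hrow (weight F β) Set.univ g v) (funext ih)

theorem Transient.green_ne_top {F : A → ℝ} {β : ℝ} (h : Γ.Transient F β)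
    (hconn : Γ.StronglyConnected) (x v : V) :
    green hrow (weight F β) Set.univ x v ≠ ∞ := by
  refine green_univ_ne_top hrow _ hconn (weight_pos F β) (fun u htop => h ⟨u, ?_⟩) x v
  rw [← htop, green]
  exact tsum_congr fun n => weightMatrixPow_eq hrow F β n u u

end Potential

/-! ### The Borel structure of the path space -/

/-- The infinite paths whose first `n + 1` arrows are those of `x`. -/
def cylinder (n : ℕ) (x : Γ.InfPath) : Set Γ.InfPath := {p | ∀ i ≤ n, p.1 i = x.1 i}

theorem self_mem_cylinder (n : ℕ) (x : Γ.InfPath) : x ∈ cylinder n x := fun _ _ => rfl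

theorem isOpen_setOf_arrow_mem (n : ℕ) (S : Set A) : IsOpen {p : Γ.InfPath | p.1 n ∈ S} := by
  let _ : TopologicalSpace A := ⊥
  have : DiscreteTopology A := ⟨rfl⟩
  exact ⟨{x | x n ∈ S}, (isOpen_discrete S).preimage (continuous_apply n), rfl⟩

theorem measurableSet_arrow_mem (n : ℕ) (S : Set A) :
    MeasurableSet {p : Γ.InfPath | p.1 n ∈ S} :=
  (isOpen_setOf_arrow_mem n S).measurableSet

theorem measurableSet_vertex_mem (n : ℕ) (S : Set V) :
    MeasurableSet {p : Γ.InfPath | p.vertex n ∈ S} :=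
  measurableSet_arrow_mem n (Γ.s ⁻¹' S)

theorem measurableSet_vertexCylinder (v : V) : MeasurableSet (Γ.vertexCylinder v) :=
  measurableSet_vertex_mem 0 {v}

theorem measurableSet_arrowCylinder (a : A) : MeasurableSet (Γ.arrowCylinder a) :=
  measurableSet_arrow_mem 0 {a}

theorem measurableSet_cylinder (n : ℕ) (x : Γ.InfPath) : MeasurableSet (cylinder n x) := by
  have : cylinder n x = ⋂ i ∈ Set.Iic n, {p : Γ.InfPath | p.1 i ∈ ({x.1 i} : Set A)} := by
    ext p
    simp [cylinder]
  rw [this]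
  exact MeasurableSet.biInter (Set.to_countable _) fun i _ => measurableSet_arrow_mem i _

variable (Γ) in
/-- The family of all cylinders. -/
def cylinders : Set (Set Γ.InfPath) := {S | ∃ n x, S = cylinder n x}

theorem countable_cylinders [Countable A] : (cylinders Γ).Countable := by
  let g : (Σ n : ℕ, (Fin (n + 1) → A)) → Set Γ.InfPath :=
    fun y => {p | ∀ i : Fin (y.1 + 1), p.1 i = y.2 i}
  refine (Set.countable_range g).mono ?_
  rintro _ ⟨n, x, rfl⟩
  refine ⟨⟨n, fun i => x.1 i⟩, ?_⟩
  ext p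
  exact ⟨fun h i hi => h ⟨i, Nat.lt_succ_of_le hi⟩, fun h i => h i (Nat.le_of_lt_succ i.2)⟩

theorem exists_cylinder_subset {U : Set Γ.InfPath} (hU : IsOpen U) {p : Γ.InfPath} (hp : p ∈ U) :
    ∃ n, cylinder n p ⊆ U := by
  let _ : TopologicalSpace A := ⊥
  obtain ⟨W, hW, rfl⟩ := hU
  obtain ⟨I, u, hu, hI⟩ := isOpen_pi_iff.1 hW p.1 hp
  refine ⟨I.sup id, fun q hq => hI fun i hi => ?_⟩
  have h : q.1 i = p.1 i := hq i (Finset.le_sup (f := id) hi)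
  change q.1 i ∈ u i
  exact h ▸ (hu i hi).2

theorem borel_eq_generateFrom_cylinders [Countable A] :
    (inferInstance : MeasurableSpace Γ.InfPath) = MeasurableSpace.generateFrom (cylinders Γ) := by
  apply le_antisymm
  · refine MeasurableSpace.generateFrom_le fun U hU => ?_
    have : U = ⋃₀ {S ∈ cylinders Γ | S ⊆ U} := by
      apply Set.Subset.antisymm
      · intro p hp
        obtain ⟨n, hn⟩ := exists_cylinder_subset hU hp
        exact ⟨_, ⟨⟨n, p, rfl⟩, hn⟩, self_mem_cylinder n p⟩
      · exact Set.sUnion_subset fun S hS => hS.2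
    rw [this]
    exact MeasurableSet.sUnion (countable_cylinders.mono fun S hS => hS.1)
      fun S hS => MeasurableSpace.measurableSet_generateFrom hS.1
  · refine MeasurableSpace.generateFrom_le ?_
    rintro _ ⟨n, x, rfl⟩
    exact measurableSet_cylinder n x

theorem isPiSystem_cylinders : IsPiSystem (cylinders Γ) := by
  rintro _ ⟨n, x, rfl⟩ _ ⟨m, y, rfl⟩ ⟨p, hp, hp'⟩
  refine ⟨max n m, p, ?_⟩
  ext q
  refine ⟨fun h i hi => ?_, fun h => ⟨fun i hi => ?_, fun i hi => ?_⟩⟩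
  · rcases le_max_iff.1 hi with hi | hi
    · rw [h.1 i hi, hp i hi]
    · rw [h.2 i hi, hp' i hi]
  · rw [h i (hi.trans (le_max_left _ _)), hp i hi]
  · rw [h i (hi.trans (le_max_right _ _)), hp' i hi]

theorem ext_of_cylinders [Countable A] {μ ν : Measure Γ.InfPath}
    (hfin : ∀ v, μ (Γ.vertexCylinder v) ≠ ∞)
    (h : ∀ n x, μ (cylinder n x) = ν (cylinder n x)) : μ = ν := by
  refine Measure.ext_of_generateFrom_of_cover_subset (T := cylinders Γ)
    borel_eq_generateFrom_cylinders isPiSystem_cylinders subset_rfl countable_cylinders ?_ ?_ ?_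
  · exact Set.eq_univ_of_forall fun p => ⟨_, ⟨0, p, rfl⟩, self_mem_cylinder 0 p⟩
  · rintro _ ⟨n, x, rfl⟩
    refine ne_top_of_le_ne_top (hfin (x.vertex 0)) (measure_mono fun p hp => ?_)
    exact congrArg Γ.s (hp 0 (Nat.zero_le _))
  · rintro _ ⟨n, x, rfl⟩
    exact h n x

/-! ### Prepending an arrow -/

/-- The infinite path obtained by prepending an arrow. -/
def InfPath.cons (a : A) (p : Γ.InfPath) (h : Γ.r a = p.vertex 0) : Γ.InfPath :=
  ⟨fun | 0 => a | n + 1 => p.1 n, fun | 0 => h | n + 1 => p.2 n⟩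

@[simp]
theorem shift_cons (a : A) (p : Γ.InfPath) (h : Γ.r a = p.vertex 0) :
    Γ.shift (.cons a p h) = p := rfl

theorem shift_mem_vertexCylinder {a : A} {p : Γ.InfPath} (hp : p ∈ Γ.arrowCylinder a) :
    Γ.shift p ∈ Γ.vertexCylinder (Γ.r a) := by
  change Γ.s (p.1 1) = Γ.r a
  rw [← p.2 0]
  exact congrArg Γ.r hp

theorem shift_image_preimage_inter (a : A) (B : Set Γ.InfPath) :
    Γ.shift '' (Γ.shift ⁻¹' B ∩ Γ.arrowCylinder a) = Γ.vertexCylinder (Γ.r a) ∩ B := by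
  ext q
  constructor
  · rintro ⟨p, ⟨hB, ha⟩, rfl⟩
    exact ⟨shift_mem_vertexCylinder ha, hB⟩
  · rintro ⟨hv, hB⟩
    exact ⟨.cons a q (Eq.symm hv), ⟨hB, rfl⟩, rfl⟩

theorem injOn_shift (a : A) : Set.InjOn Γ.shift (Γ.arrowCylinder a) := by
  intro p hp q hq h
  apply Subtype.ext
  funext i
  cases i with
  | zero => exact hp.trans hq.symm
  | succ i => exact congrFun (congrArg Subtype.val h) i

theorem cylinder_zero (x : Γ.InfPath) : cylinder 0 x = Γ.arrowCylinder (x.1 0) := by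
  ext p
  simp [cylinder, arrowCylinder]

theorem cylinder_succ (n : ℕ) (x : Γ.InfPath) :
    cylinder (n + 1) x = Γ.arrowCylinder (x.1 0) ∩ Γ.shift ⁻¹' cylinder n (Γ.shift x) := by
  ext p
  constructor
  · exact fun h => ⟨h 0 (Nat.zero_le _), fun i hi => h (i + 1) (Nat.succ_le_succ hi)⟩
  · rintro ⟨h₀, h⟩ i hi
    cases i with
    | zero => exact h₀
    | succ i => exact h i (Nat.le_of_succ_le_succ hi)

theorem cylinder_subset_vertexCylinder (n : ℕ) (x : Γ.InfPath) :
    cylinder n x ⊆ Γ.vertexCylinder (x.vertex 0) :=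
  fun _ hp => congrArg Γ.s (hp 0 (Nat.zero_le _))

theorem measurable_shift : Measurable Γ.shift := by
  let _ : TopologicalSpace A := ⊥
  refine Continuous.measurable (continuous_induced_rng.2 (continuous_pi fun i => ?_))
  exact (continuous_apply (i + 1)).comp continuous_induced_dom

theorem measurableSet_shift_image [Countable A] (a : A) {B : Set Γ.InfPath}
    (hB : MeasurableSet B) : MeasurableSet (Γ.shift '' (B ∩ Γ.arrowCylinder a)) := by
  refine MeasurableSpace.induction_on_inter
    (C := fun B _ => MeasurableSet (Γ.shift '' (B ∩ Γ.arrowCylinder a)))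
    borel_eq_generateFrom_cylinders isPiSystem_cylinders ?_ ?_ ?_ ?_ B hB
  · simp
  · intro B hB
    obtain ⟨n, x, rfl⟩ := hB
    have : Γ.shift '' (cylinder n x ∩ Γ.arrowCylinder a) =
        Γ.vertexCylinder (Γ.r a) ∩ ({q | x.1 0 = a} ∩
          ⋂ i ∈ Set.Iio n, {q : Γ.InfPath | q.1 i ∈ ({x.1 (i + 1)} : Set A)}) := by
      ext q
      simp only [Set.mem_inter_iff, Set.mem_iInter, Set.mem_Iio]
      constructor
      · rintro ⟨p, ⟨hp, ha⟩, rfl⟩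
        exact ⟨shift_mem_vertexCylinder ha, (hp 0 (Nat.zero_le _)).symm.trans ha,
          fun i hi => hp (i + 1) hi⟩
      · rintro ⟨hv, h0, h⟩
        refine ⟨.cons a q (Eq.symm hv), ⟨fun i hi => ?_, rfl⟩, rfl⟩
        cases i with
        | zero => exact h0.symm
        | succ i => exact h i hi
    rw [this]
    exact (measurableSet_vertexCylinder _).inter ((MeasurableSet.const _).inter
      (MeasurableSet.biInter (Set.to_countable _) fun i _ => measurableSet_arrow_mem _ _))
  · intro B _ ih
    have : Γ.shift '' (Bᶜ ∩ Γ.arrowCylinder a) =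
        Γ.vertexCylinder (Γ.r a) \ Γ.shift '' (B ∩ Γ.arrowCylinder a) := by
      ext q
      constructor
      · rintro ⟨p, ⟨hB, ha⟩, rfl⟩
        refine ⟨shift_mem_vertexCylinder ha, ?_⟩
        rintro ⟨p', ⟨hB', ha'⟩, h⟩
        exact hB (injOn_shift a ha' ha h ▸ hB')
      · rintro ⟨hv, hq⟩
        refine ⟨.cons a q (Eq.symm hv), ⟨fun hB => hq ⟨_, ⟨hB, rfl⟩, rfl⟩, rfl⟩, rfl⟩
    rw [this]
    exact (measurableSet_vertexCylinder _).diff ih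
  · intro f _ _ ih
    rw [Set.iUnion_inter, Set.image_iUnion]
    exact MeasurableSet.iUnion ih

/-! ### Conformal measures and potential theory -/

section Conformal

variable {F : A → ℝ} {β : ℝ} {m : Measure Γ.InfPath}

theorem IsConformal.measure_arrowCylinder_inter (h : Γ.IsConformal F β m) (a : A)
    {B : Set Γ.InfPath} (hB : MeasurableSet B) :
    m (Γ.arrowCylinder a ∩ Γ.shift ⁻¹' B) =
      weight F β a * m (Γ.vertexCylinder (Γ.r a) ∩ B) := by
  rw [← shift_image_preimage_inter, h.conformal a _ (measurable_shift hB), ← mul_assoc,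
    mul_comm (weight F β a : ℝ≥0∞), ofReal_exp_mul_weight, one_mul, Set.inter_comm]

theorem IsConformal.measure_inter_preimage (h : Γ.IsConformal F β m) (hrow : Γ.RowFinite)
    (D : Set V) {B : Set Γ.InfPath} (hB : MeasurableSet B) (v : V) :
    m (Γ.vertexCylinder v ∩ ({p | p.vertex 0 ∈ D} ∩ Γ.shift ⁻¹' B)) =
      step hrow (weight F β) D (fun u => m (Γ.vertexCylinder u ∩ B)) v := by
  by_cases hv : v ∈ D
  · rw [step_apply_of_mem hrow _ hv]
    have : Γ.vertexCylinder v ∩ ({p | p.vertex 0 ∈ D} ∩ Γ.shift ⁻¹' B) =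
        ⋃ a ∈ outArrows hrow v, (Γ.arrowCylinder a ∩ Γ.shift ⁻¹' B) := by
      ext p
      simp only [Set.mem_inter_iff, Set.mem_iUnion, mem_outArrows, exists_prop]
      constructor
      · rintro ⟨h0, -, hB⟩
        exact ⟨p.1 0, h0, rfl, hB⟩
      · rintro ⟨a, ha, h0, hB⟩
        have : p.vertex 0 = v := (congrArg Γ.s h0).trans ha
        exact ⟨this, by simpa [this] using hv, hB⟩
    rw [this, measure_biUnion_finset]
    · exact Finset.sum_congr rfl fun a _ => h.measure_arrowCylinder_inter a hB
    · intro a _ b _ hab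
      refine Set.disjoint_left.2 fun p hp hq => hab ?_
      exact (Eq.symm hp.1).trans hq.1
    · exact fun a _ => (measurableSet_arrowCylinder a).inter (measurable_shift hB)
  · rw [step_apply_of_notMem hrow _ hv]
    convert measure_empty (μ := m)
    refine Set.eq_empty_of_forall_notMem fun p hp => hv ?_
    have h0 : p.vertex 0 = v := hp.1
    exact h0 ▸ hp.2.1

theorem IsConformal.measure_inter_preimage_iterate (h : Γ.IsConformal F β m)
    (hrow : Γ.RowFinite) {B : Set Γ.InfPath} (hB : MeasurableSet B) (n : ℕ) :
    (fun v => m (Γ.vertexCylinder v ∩ (Γ.shift^[n]) ⁻¹' B)) =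
      (step hrow (weight F β) Set.univ ^ n) (fun v => m (Γ.vertexCylinder v ∩ B)) := by
  induction n with
  | zero => rfl
  | succ n ih =>
    rw [pow_succ', Module.End.mul_apply, ← ih]
    ext v
    rw [← h.measure_inter_preimage hrow Set.univ (measurable_shift.iterate n hB) v]
    simp only [Set.mem_univ, Set.ofPred_true, Set.univ_inter, Function.iterate_succ,
      Set.preimage_comp]

theorem IsConformal.harmonic (h : Γ.IsConformal F β m) (hrow : Γ.RowFinite) (v : V) :
    m (Γ.vertexCylinder v) =
      step hrow (weight F β) Set.univ (fun u => m (Γ.vertexCylinder u)) v := by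
  have := h.measure_inter_preimage hrow Set.univ MeasurableSet.univ v
  simpa using this

theorem iterate_shift_apply (n : ℕ) (p : Γ.InfPath) (i : ℕ) :
    (Γ.shift^[n] p).1 i = p.1 (i + n) := by
  induction n generalizing p with
  | zero => rfl
  | succ n ih => rw [Function.iterate_succ_apply, ih]; exact congrArg p.1 (by omega)

theorem iterate_shift_vertex (n : ℕ) (p : Γ.InfPath) (i : ℕ) :
    (Γ.shift^[n] p).vertex i = p.vertex (i + n) :=
  congrArg Γ.s (iterate_shift_apply n p i)

variable (Γ) in
/-- The infinite paths all of whose vertices are in `D`. -/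
def staysIn (D : Set V) : Set Γ.InfPath := {p | ∀ i, p.vertex i ∈ D}

theorem measurableSet_staysIn (D : Set V) : MeasurableSet (Γ.staysIn D) := by
  have : Γ.staysIn D = ⋂ i, {p : Γ.InfPath | p.vertex i ∈ D} := by
    ext p
    simp [staysIn]
  rw [this]
  exact MeasurableSet.iInter fun i => measurableSet_vertex_mem i D

theorem IsConformal.tendsto_step_pow (h : Γ.IsConformal F β m) (hrow : Γ.RowFinite) (D : Set V)
    (v : V) :
    Filter.Tendsto
      (fun n : ℕ => (step hrow (weight F β) D ^ n) (fun u => m (Γ.vertexCylinder u)) v)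
      Filter.atTop (nhds (m (Γ.vertexCylinder v ∩ Γ.staysIn D))) := by
  let S : ℕ → Set Γ.InfPath := fun n => {p | ∀ i < n, p.vertex i ∈ D}
  have hS : ∀ n, MeasurableSet (S n) := fun n => by
    have : S n = ⋂ i ∈ Set.Iio n, {p : Γ.InfPath | p.vertex i ∈ D} := by
      ext p
      simp [S]
    rw [this]
    exact MeasurableSet.biInter (Set.to_countable _) fun i _ => measurableSet_vertex_mem i D
  have hstep : ∀ n, (fun v => m (Γ.vertexCylinder v ∩ S n)) =
      (step hrow (weight F β) D ^ n) (fun u => m (Γ.vertexCylinder u)) := by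
    intro n
    induction n with
    | zero => simp [S]
    | succ n ih =>
      rw [pow_succ', Module.End.mul_apply, ← ih]
      ext v
      rw [← h.measure_inter_preimage hrow D (hS n) v]
      congr 2
      ext p
      constructor
      · exact fun hp => ⟨hp 0 (Nat.succ_pos _), fun i hi => hp (i + 1) (Nat.succ_lt_succ hi)⟩
      · rintro ⟨h0, hp⟩ i hi
        cases i with
        | zero => exact h0
        | succ i => exact hp i (Nat.lt_of_succ_lt_succ hi)
  have hInter : Γ.vertexCylinder v ∩ Γ.staysIn D = ⋂ n, (Γ.vertexCylinder v ∩ S n) := by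
    rw [← Set.inter_iInter]
    congr 1
    ext p
    simp only [staysIn, S, Set.mem_ofPred_eq, Set.mem_iInter]
    exact ⟨fun hp _ i _ => hp i, fun hp i => hp (i + 1) i (Nat.lt_succ_self i)⟩
  rw [hInter]
  simp only [← hstep]
  refine tendsto_measure_iInter_atTop
    (fun n => ((measurableSet_vertexCylinder v).inter (hS n)).nullMeasurableSet) ?_ ⟨0, ?_⟩
  · exact fun n k hnk p hp => ⟨hp.1, fun i hi => hp.2 i (hi.trans_le hnk)⟩
  · exact ne_top_of_le_ne_top (h.regular v).ne (measure_mono Set.inter_subset_left)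

/-- The mass of `Z(v)` is the sum of the mass of the paths that reach `K` and the mass of the
paths that stay in `D` forever. -/
theorem IsConformal.measure_vertexCylinder_eq (h : Γ.IsConformal F β m) (hrow : Γ.RowFinite)
    {D : Set V} {K : Finset V} (hK : ∀ k ∈ K, k ∉ D)
    (hDK : ∀ a, Γ.s a ∈ D → Γ.r a ∈ D ∨ Γ.r a ∈ K) {v : V} (hv : v ∈ D) :
    m (Γ.vertexCylinder v) =
      ∑ k ∈ K, green hrow (weight F β) D k v * m (Γ.vertexCylinder k) +
        m (Γ.vertexCylinder v ∩ Γ.staysIn D) := by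
  classical
  have h3 := (tendsto_sum_exit hrow (weight F β) D K (f := fun u => m (Γ.vertexCylinder u))
    (fun u => (h.regular u).ne) v).add (h.tendsto_step_pow hrow D v)
  refine tendsto_nhds_unique (tendsto_const_nhds.congr fun n => ?_) h3
  exact eq_sum_exit_add hrow _ hK hDK (f := fun u => m (Γ.vertexCylinder u))
    (fun u _ => h.harmonic hrow u) n hv

theorem measure_eq_zero_of_forall_vertexCylinder [Countable V] {B : Set Γ.InfPath}
    (h : ∀ v, m (Γ.vertexCylinder v ∩ B) = 0) : m B = 0 := by
  have : B = ⋃ v, (Γ.vertexCylinder v ∩ B) := by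
    ext p
    simp [vertexCylinder]
  rw [this]
  exact measure_iUnion_null h

theorem IsConformal.measure_preimage_iterate_eq_zero [Countable V] (h : Γ.IsConformal F β m)
    (hrow : Γ.RowFinite) {B : Set Γ.InfPath} (hB : MeasurableSet B) (hm : m B = 0) (n : ℕ) :
    m ((Γ.shift^[n]) ⁻¹' B) = 0 := by
  refine measure_eq_zero_of_forall_vertexCylinder fun v => ?_
  have h1 := congrFun (h.measure_inter_preimage_iterate hrow hB n) v
  have h2 : (fun v => m (Γ.vertexCylinder v ∩ B)) = 0 :=
    funext fun v => measure_inter_null_of_null_right _ hm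
  rw [h1, h2, map_zero]
  rfl

theorem IsConformal.ae_isWandering [Countable V] (h : Γ.IsConformal F β m) (hrow : Γ.RowFinite)
    (hfin : ∀ x v, green hrow (weight F β) Set.univ x v ≠ ∞) : ∀ᵐ p ∂m, p.IsWandering := by
  classical
  have key : ∀ u, ∀ᵐ p ∂m, ¬ ∃ᶠ n in Filter.atTop, p.vertex n = u := by
    intro u
    rw [ae_iff]
    simp only [not_not]
    refine measure_eq_zero_of_forall_vertexCylinder fun v => ?_
    have h1 : ∀ n, m {p | p ∈ Γ.vertexCylinder v ∧ p.vertex n = u} =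
        m (Γ.vertexCylinder u) *
          (step hrow (weight F β) Set.univ ^ n) (Pi.single u 1) v := by
      intro n
      have h2 : (fun v => m (Γ.vertexCylinder v ∩ Γ.vertexCylinder u)) =
          m (Γ.vertexCylinder u) • Pi.single u 1 := by
        ext v
        by_cases huv : v = u
        · simp [huv]
        · have : Γ.vertexCylinder v ∩ Γ.vertexCylinder u = ∅ :=
            Set.eq_empty_of_forall_notMem fun p hp => huv (Eq.symm hp.1 |>.trans hp.2)
          simp [this, huv]
      have h3 := congrFun
        (h.measure_inter_preimage_iterate hrow (measurableSet_vertexCylinder u) n) v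
      rw [h2, map_smul, Pi.smul_apply, smul_eq_mul] at h3
      rw [← h3]
      congr 1
      ext p
      simp only [vertexCylinder, Set.mem_inter_iff, Set.mem_preimage, Set.mem_ofPred_eq,
        iterate_shift_vertex, zero_add]
    have h4 : ∑' n, m {p | p ∈ Γ.vertexCylinder v ∧ p.vertex n = u} ≠ ∞ := by
      simp only [h1, ENNReal.tsum_mul_left]
      refine ENNReal.mul_ne_top (h.regular u).ne ?_
      convert hfin u v
      rw [green]
    refine measure_mono_null ?_ (measure_setOfPred_frequently_eq_zero h4)
    exact fun p hp => Filter.Frequently.mono hp.2 fun n hn => ⟨hp.1, hn⟩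
  filter_upwards [ae_all_iff.2 key] with p hp K
  simp only [Filter.not_frequently, Filter.eventually_atTop] at hp
  choose N hN using hp
  exact ⟨K.sup N, fun i hi hiK => hN _ i ((Finset.le_sup hiK).trans hi) rfl⟩

/-- The paths that eventually stay in `D` are negligible as soon as those that always stay in `D`
are. -/
theorem IsConformal.ae_frequently_notMem [Countable V] (h : Γ.IsConformal F β m)
    (hrow : Γ.RowFinite) {D : Set V} (hD : ∀ v ∈ D, m (Γ.vertexCylinder v ∩ Γ.staysIn D) = 0) :
    ∀ᵐ p ∂m, ∃ᶠ n in Filter.atTop, p.vertex n ∉ D := by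
  have h0 : m (Γ.staysIn D) = 0 := by
    refine measure_eq_zero_of_forall_vertexCylinder fun v => ?_
    by_cases hv : v ∈ D
    · exact hD v hv
    · convert measure_empty (μ := m)
      refine Set.eq_empty_of_forall_notMem fun p hp => hv ?_
      have h0 : p.vertex 0 = v := hp.1
      exact h0 ▸ hp.2 0
  have h1 : ∀ n, ∀ᵐ p ∂m, p ∉ (Γ.shift^[n]) ⁻¹' Γ.staysIn D := fun n =>
    measure_eq_zero_iff_ae_notMem.1
      (h.measure_preimage_iterate_eq_zero hrow (measurableSet_staysIn D) h0 n)
  filter_upwards [ae_all_iff.2 h1] with p hp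
  rw [Filter.frequently_atTop]
  intro n
  by_contra! hn
  refine hp n fun i => ?_
  rw [iterate_shift_vertex]
  exact hn _ (Nat.le_add_left n i)

theorem IsConformal.measure_cylinder_eq [Countable A] {m' : Measure Γ.InfPath}
    (h : Γ.IsConformal F β m) (h' : Γ.IsConformal F β m') {c : ℝ≥0∞}
    (hc : ∀ v, m' (Γ.vertexCylinder v) = c * m (Γ.vertexCylinder v)) (n : ℕ) (x : Γ.InfPath) :
    m' (cylinder n x) = c * m (cylinder n x) := by
  induction n generalizing x with
  | zero =>
    have h1 := h.measure_arrowCylinder_inter (x.1 0) MeasurableSet.univ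
    have h2 := h'.measure_arrowCylinder_inter (x.1 0) MeasurableSet.univ
    simp only [Set.preimage_univ, Set.inter_univ] at h1 h2
    rw [cylinder_zero, h1, h2, hc, mul_left_comm]
  | succ n ih =>
    have hsub : Γ.vertexCylinder (Γ.r (x.1 0)) ∩ cylinder n (Γ.shift x) =
        cylinder n (Γ.shift x) := by
      refine Set.inter_eq_right.2 ?_
      rw [x.2 0]
      exact cylinder_subset_vertexCylinder n _
    rw [cylinder_succ, h.measure_arrowCylinder_inter _ (measurableSet_cylinder _ _),
      h'.measure_arrowCylinder_inter _ (measurableSet_cylinder _ _), hsub, ih, mul_left_comm]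

theorem IsConformal.eq_smul [Countable A] {m' : Measure Γ.InfPath}
    (h : Γ.IsConformal F β m) (h' : Γ.IsConformal F β m') {c : ℝ≥0}
    (hc : ∀ v, m' (Γ.vertexCylinder v) = c * m (Γ.vertexCylinder v)) : m' = c • m := by
  refine ext_of_cylinders (fun v => (h'.regular v).ne) fun n x => ?_
  rw [h.measure_cylinder_eq h' hc]
  rfl

/-- The restriction of a conformal measure to a shift-invariant Borel set is conformal unless it
vanishes. -/
theorem IsConformal.restrict (h : Γ.IsConformal F β m) {B : Set Γ.InfPath} (hB : MeasurableSet B)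
    (hinv : Γ.shift ⁻¹' B = B) (hne : m B ≠ 0) : Γ.IsConformal F β (m.restrict B) where
  ne_zero h0 := hne (Measure.restrict_eq_zero.1 h0)
  regular v := (Measure.restrict_apply_le _ _).trans_lt (h.regular v)
  conformal a C hC := by
    have h1 : Γ.shift '' (C ∩ Γ.arrowCylinder a) ∩ B =
        Γ.shift '' ((C ∩ B) ∩ Γ.arrowCylinder a) := by
      ext q
      constructor
      · rintro ⟨⟨p, ⟨hp, ha⟩, rfl⟩, hq⟩
        have : p ∈ Γ.shift ⁻¹' B := hq
        rw [hinv] at this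
        exact ⟨p, ⟨⟨hp, this⟩, ha⟩, rfl⟩
      · rintro ⟨p, ⟨⟨hp, hpB⟩, ha⟩, rfl⟩
        rw [← hinv] at hpB
        exact ⟨⟨p, ⟨hp, ha⟩, rfl⟩, hpB⟩
    rw [Measure.restrict_apply' hB, Measure.restrict_apply' hB, h1, h.conformal a _ (hC.inter hB),
      Set.inter_right_comm]

/-- Extremal conformal measures are ergodic for the shift. -/
theorem IsExtremalConformal.measure_eq_zero_or (h : Γ.IsExtremalConformal F β m)
    {B : Set Γ.InfPath} (hB : MeasurableSet B) (hinv : Γ.shift ⁻¹' B = B) :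
    m B = 0 ∨ m Bᶜ = 0 := by
  by_cases hne : m B = 0
  · exact Or.inl hne
  · right
    obtain ⟨c, hc, hm⟩ := h.extremal _ (h.isConformal.restrict hB hinv hne)
      Measure.restrict_le_self
    have h1 : (m.restrict B) Bᶜ = 0 := by simp [Measure.restrict_apply' hB]
    rw [hm, Measure.smul_apply, ENNReal.smul_def, smul_eq_mul, mul_eq_zero] at h1
    exact h1.resolve_left (by simpa using hc.ne')

/-- An extremal conformal measure that lives on the wandering paths is concentrated on an end. -/
theorem IsExtremalConformal.exists_concentratedOn [Countable V]
    (h : Γ.IsExtremalConformal F β m) (hwan : ∀ᵐ p ∂m, p.IsWandering) :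
    ∃ E, Γ.ConcentratedOn m E := by
  let B : Finset V → V → Set Γ.InfPath := fun K u =>
    {p | ∃ᶠ n in Filter.atTop, Γ.ReachAvoiding K u (p.vertex n)}
  have hBm : ∀ K u, MeasurableSet (B K u) := fun K u => by
    have : B K u = ⋂ N, ⋃ n, ⋃ _ : n ≥ N,
        {p : Γ.InfPath | p.vertex n ∈ {x | Γ.ReachAvoiding K u x}} := by
      ext p
      simp [B, Filter.frequently_atTop]
    rw [this]
    exact MeasurableSet.iInter fun N => MeasurableSet.iUnion fun n => MeasurableSet.iUnion fun _ =>
      measurableSet_vertex_mem n _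
  have hBi : ∀ K u, Γ.shift ⁻¹' B K u = B K u := fun K u => by
    ext p
    have := Filter.frequently_map (f := Filter.atTop) (m := fun n : ℕ => n + 1)
      (P := fun n => Γ.ReachAvoiding K u (p.vertex n))
    rw [Filter.map_add_atTop_eq_nat] at this
    exact this.symm
  have hB : ∀ K u, ∃ b : Prop, ∀ᵐ p ∂m, p ∈ B K u ↔ b := fun K u => by
    rcases h.measure_eq_zero_or (hBm K u) (hBi K u) with h0 | h0
    · refine ⟨False, ?_⟩
      filter_upwards [measure_eq_zero_iff_ae_notMem.1 h0] with p hp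
      simpa using hp
    · refine ⟨True, ?_⟩
      filter_upwards [measure_eq_zero_iff_ae_notMem.1 h0] with p hp
      simpa using hp
  choose b hb using hB
  have hae := hwan.and (ae_all_iff.2 fun K => ae_all_iff.2 fun u => hb K u)
  have key : ∀ p q : Γ.Wan, (∀ K u, p.1 ∈ B K u ↔ b K u) → (∀ K u, q.1 ∈ B K u ↔ b K u) →
      Γ.Leads p q := by
    intro p q hp hq K N
    obtain ⟨M, hM⟩ := p.2 K
    have hM' : ∀ i ≥ max N M, p.1.vertex i ∉ K :=
      fun i hi => hM i ((le_max_right _ _).trans hi)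
    have h1 : p.1 ∈ B K (p.1.vertex (max N M)) :=
      (Filter.eventually_atTop.2 ⟨max N M, fun n hn => .along p.1 hn hM'⟩).frequently
    rw [hp, ← hq] at h1
    obtain ⟨n, hn, h2⟩ := Filter.frequently_atTop.1 h1 N
    exact ⟨_, le_max_left _ _, n, hn, h2⟩
  have : (ae m).NeBot := ae_neBot.2 h.isConformal.ne_zero
  obtain ⟨p, hpw, hp⟩ := hae.exists
  refine ⟨Quotient.mk Γ.wanSetoid ⟨p, hpw⟩, ?_⟩
  change ∀ᵐ q ∂m, q ∈ EndSpace.carrier _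
  filter_upwards [hae] with q hq
  exact ⟨hq.1, Quotient.sound ⟨key ⟨q, hq.1⟩ ⟨p, hpw⟩ hq.2 hp, key ⟨p, hpw⟩ ⟨q, hq.1⟩ hp hq.2⟩⟩

theorem ConcentratedOn.unique (hm : m ≠ 0) {E E' : Γ.EndSpace} (h : Γ.ConcentratedOn m E)
    (h' : Γ.ConcentratedOn m E') : E = E' := by
  have h1 : ∀ᵐ p ∂m, p ∈ E.carrier := h
  have h2 : ∀ᵐ p ∂m, p ∈ E'.carrier := h'
  have : (ae m).NeBot := ae_neBot.2 hm
  obtain ⟨p, ⟨_, hp⟩, ⟨_, hp'⟩⟩ := (h1.and h2).exists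
  exact hp.symm.trans hp'

end Conformal

/-! ### The conformal measure of a positive harmonic function -/

section Markov

open ProbabilityTheory

theorem setOf_forall_le_eq (n : ℕ) (x : ℕ → A) : {y : ℕ → A | ∀ i ≤ n, y i = x i} =
    Preorder.frestrictLe (π := fun _ => A) n ⁻¹' {Preorder.frestrictLe (π := fun _ => A) n x} := by
  ext y
  simp [funext_iff, Preorder.frestrictLe]

theorem injective_val : Function.Injective fun p : Γ.InfPath => p.1 := Subtype.val_injective

variable [MeasurableSpace A] [MeasurableSingletonClass A]

theorem measurableSet_setOf_forall_le_eq (n : ℕ) (x : ℕ → A) :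
    MeasurableSet {y : ℕ → A | ∀ i ≤ n, y i = x i} := by
  rw [setOf_forall_le_eq]
  exact Preorder.measurable_frestrictLe (X := fun _ => A) n (measurableSet_singleton _)

/-- The law of the Markov chain with transition kernel `κ`, started with the weights `c`. -/
noncomputable def chainMeasure (c : A → ℝ≥0) (κ : Kernel A A) [IsMarkovKernel κ] :
    Measure (ℕ → A) :=
  Measure.sum fun a => c a • Kernel.traj (X := fun _ => A)
    (fun n => κ.comap (fun y : (i : Finset.Iic n) → A => y ⟨n, by simp⟩)
      (measurable_pi_apply _)) 0 (fun _ => a)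

theorem chainMeasure_zero (c : A → ℝ≥0) (κ : Kernel A A) [IsMarkovKernel κ] (x : ℕ → A) :
    chainMeasure c κ {y | ∀ i ≤ 0, y i = x i} = c (x 0) := by
  classical
  rw [chainMeasure, Measure.sum_apply _ (measurableSet_setOf_forall_le_eq 0 x)]
  rw [tsum_eq_single (x 0)]
  · rw [setOf_forall_le_eq, Measure.smul_apply,
      ← Measure.map_apply (Preorder.measurable_frestrictLe 0) (measurableSet_singleton _),
      Kernel.traj_map_frestrictLe_apply, Kernel.partialTraj_self, Kernel.id_apply,
      Measure.dirac_apply' _ (measurableSet_singleton _), Set.indicator_of_mem]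
    · simp [ENNReal.smul_def]
    · funext i
      obtain ⟨i, hi⟩ := i
      obtain rfl : i = 0 := by simpa using hi
      rfl
  · intro a ha
    rw [setOf_forall_le_eq, Measure.smul_apply,
      ← Measure.map_apply (Preorder.measurable_frestrictLe 0) (measurableSet_singleton _),
      Kernel.traj_map_frestrictLe_apply, Kernel.partialTraj_self, Kernel.id_apply,
      Measure.dirac_apply' _ (measurableSet_singleton _), Set.indicator_of_notMem, smul_zero]
    exact fun h => ha (congrFun h ⟨0, by simp⟩)

theorem chainMeasure_succ (c : A → ℝ≥0) (κ : Kernel A A) [IsMarkovKernel κ] (n : ℕ) (x : ℕ → A) :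
    chainMeasure c κ {y | ∀ i ≤ n + 1, y i = x i} =
      κ (x n) {x (n + 1)} * chainMeasure c κ {y | ∀ i ≤ n, y i = x i} := by
  rw [chainMeasure, Measure.sum_apply _ (measurableSet_setOf_forall_le_eq _ x),
    Measure.sum_apply _ (measurableSet_setOf_forall_le_eq _ x), ← ENNReal.tsum_mul_left]
  refine tsum_congr fun a => ?_
  rw [Measure.smul_apply, Measure.smul_apply, mul_smul_comm]
  congr 1
  set η : (n : ℕ) → Kernel ((i : Finset.Iic n) → A) A := fun n =>
    κ.comap (fun y : (i : Finset.Iic n) → A => y ⟨n, by simp⟩) (measurable_pi_apply _) with hη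
  have h1 : {y : ℕ → A | ∀ i ≤ n + 1, y i = x i} =
      (fun y => (Preorder.frestrictLe (π := fun _ => A) n y, y (n + 1))) ⁻¹'
        ({Preorder.frestrictLe (π := fun _ => A) n x} ×ˢ {x (n + 1)}) := by
    ext y
    simp only [Set.mem_preimage, Set.mem_prod, Set.mem_singleton_iff]
    rw [← Set.mem_singleton_iff, ← Set.mem_preimage, ← setOf_forall_le_eq]
    exact ⟨fun h => ⟨fun i hi => h i (hi.trans (Nat.le_succ n)), h _ le_rfl⟩, fun h i hi =>
      (Nat.le_succ_iff.1 hi).elim (h.1 i) fun hi => hi ▸ h.2⟩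
  rw [h1, ← Measure.map_apply (by fun_prop)
      ((measurableSet_singleton _).prod (measurableSet_singleton _)),
    ← Kernel.partialTraj_compProd_eq_map_traj (X := fun _ => A) (κ := η) (Nat.zero_le n),
    Measure.compProd_apply_prod (measurableSet_singleton _) (measurableSet_singleton _),
    lintegral_singleton, setOf_forall_le_eq,
    ← Measure.map_apply (Preorder.measurable_frestrictLe n) (measurableSet_singleton _),
    Kernel.traj_map_frestrictLe_apply]
  rfl

variable [Countable A]

/-- The Markov chain on the arrows given by the `ψ`-transform of the weights `w`. -/
noncomputable def arrowKernel (hrow : Γ.RowFinite) (w : A → ℝ≥0) (ψ : V → ℝ≥0) : Kernel A A :=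
  Kernel.ofFunOfCountable fun a =>
    ∑ b ∈ outArrows hrow (Γ.r a), (w b * ψ (Γ.r b) / ψ (Γ.r a)) • Measure.dirac b

theorem isMarkovKernel_arrowKernel (hrow : Γ.RowFinite) {w : A → ℝ≥0} {ψ : V → ℝ≥0}
    (hpos : ∀ v, 0 < ψ v) (hψ : ∀ v, ∑ a ∈ outArrows hrow v, w a * ψ (Γ.r a) = ψ v) :
    IsMarkovKernel (arrowKernel hrow w ψ) where
  isProbabilityMeasure a := ⟨by
    have : ∑ b ∈ outArrows hrow (Γ.r a), w b * ψ (Γ.r b) / ψ (Γ.r a) = 1 := by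
      rw [← Finset.sum_div, hψ, div_self (hpos _).ne']
    simp only [arrowKernel, Kernel.ofFunOfCountable, Kernel.coe_mk, Measure.coe_finsetSum,
      Finset.sum_apply, Measure.smul_apply, measure_univ, ENNReal.smul_def, smul_eq_mul, mul_one]
    exact_mod_cast this⟩

theorem arrowKernel_singleton (hrow : Γ.RowFinite) (w : A → ℝ≥0) (ψ : V → ℝ≥0) {a b : A}
    (h : Γ.r a = Γ.s b) :
    arrowKernel hrow w ψ a {b} = ((w b * ψ (Γ.r b) / ψ (Γ.r a) : ℝ≥0) : ℝ≥0∞) := by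
  classical
  simp only [arrowKernel, Kernel.ofFunOfCountable, Kernel.coe_mk, Measure.coe_finsetSum,
      Finset.sum_apply, Measure.smul_apply, ENNReal.smul_def, smul_eq_mul,
      Measure.dirac_apply' _ (measurableSet_singleton b)]
  rw [Finset.sum_eq_single b]
  · simp
  · intro c _ hcb
    simp [hcb]
  · intro hb
    simp [h] at hb

theorem arrowKernel_singleton_eq_zero (hrow : Γ.RowFinite) (w : A → ℝ≥0) (ψ : V → ℝ≥0) {a b : A}
    (h : Γ.r a ≠ Γ.s b) : arrowKernel hrow w ψ a {b} = 0 := by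
  classical
  simp only [arrowKernel, Kernel.ofFunOfCountable, Kernel.coe_mk, Measure.coe_finsetSum,
      Finset.sum_apply, Measure.smul_apply, ENNReal.smul_def, smul_eq_mul,
      Measure.dirac_apply' _ (measurableSet_singleton b)]
  refine Finset.sum_eq_zero fun c hc => ?_
  rw [mem_outArrows] at hc
  have : c ≠ b := fun hcb => h (hcb ▸ hc.symm)
  simp [this]

variable (Γ) in
/-- The infinite paths as a set of sequences of arrows. -/
def pathSet : Set (ℕ → A) := {x | ∀ i, Γ.r (x i) = Γ.s (x (i + 1))}

theorem measurableSet_pathSet : MeasurableSet Γ.pathSet := by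
  have : Γ.pathSet = ⋂ i, (fun x : ℕ → A => (x i, x (i + 1))) ⁻¹'
      {q | Γ.r q.1 = Γ.s q.2} := by
    ext x
    simp [pathSet]
  rw [this]
  exact MeasurableSet.iInter fun i =>
    (by fun_prop : Measurable fun x : ℕ → A => (x i, x (i + 1))) (Set.to_countable _).measurableSet

theorem chainMeasure_compl_pathSet (c : A → ℝ≥0) (κ : Kernel A A) [IsMarkovKernel κ]
    (hκ : ∀ a b, Γ.r a ≠ Γ.s b → κ a {b} = 0) : chainMeasure c κ Γ.pathSetᶜ = 0 := by
  let T : (i : ℕ) → ((j : Finset.Iic (i + 1)) → A) → Set (ℕ → A) := fun i z =>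
    {x | Γ.r (x i) ≠ Γ.s (x (i + 1))} ∩ Preorder.frestrictLe (π := fun _ => A) (i + 1) ⁻¹' {z}
  refine measure_mono_null (t := ⋃ i, ⋃ z, T i z) ?_ ?_
  · intro x hx
    simp only [pathSet, Set.mem_compl_iff, Set.mem_ofPred_eq, not_forall] at hx
    obtain ⟨i, hi⟩ := hx
    exact Set.mem_iUnion.2 ⟨i, Set.mem_iUnion.2 ⟨_, hi, rfl⟩⟩
  · refine measure_iUnion_null fun i => measure_iUnion_null fun z => ?_
    rcases (T i z).eq_empty_or_nonempty with h | ⟨x, hx, hxz⟩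
    · rw [h, measure_empty]
    · refine measure_mono_null (t := {y | ∀ j ≤ i + 1, y j = x j}) ?_ ?_
      · rw [setOf_forall_le_eq, Set.mem_singleton_iff.1 hxz]
        exact Set.inter_subset_right
      · rw [chainMeasure_succ, hκ _ _ hx, zero_mul]

theorem measurableSet_val_image {B : Set Γ.InfPath} (hB : MeasurableSet B) :
    MeasurableSet ((fun p : Γ.InfPath => p.1) '' B) := by
  have hrange : Set.range (fun p : Γ.InfPath => p.1) = Γ.pathSet := Subtype.range_coe
  refine MeasurableSpace.induction_on_inter
    (C := fun B _ => MeasurableSet ((fun p : Γ.InfPath => p.1) '' B))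
    borel_eq_generateFrom_cylinders isPiSystem_cylinders ?_ ?_ ?_ ?_ B hB
  · simp
  · rintro _ ⟨n, x, rfl⟩
    have : (fun p : Γ.InfPath => p.1) '' cylinder n x =
        {y | ∀ i ≤ n, y i = x.1 i} ∩ Γ.pathSet := by
      rw [← hrange, ← Set.image_preimage_eq_inter_range]
      rfl
    rw [this]
    exact (measurableSet_setOf_forall_le_eq n x.1).inter measurableSet_pathSet
  · intro B _ ih
    rw [Set.image_compl_eq_range_sdiff_image injective_val, hrange]
    exact measurableSet_pathSet.diff ih
  · intro f _ _ ih
    rw [Set.image_iUnion]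
    exact MeasurableSet.iUnion ih

end Markov

theorem exists_measure_cylinder [Countable A] (hrow : Γ.RowFinite) {w : A → ℝ≥0} {ψ : V → ℝ≥0}
    (hpos : ∀ v, 0 < ψ v) (hψ : ∀ v, ∑ a ∈ outArrows hrow v, w a * ψ (Γ.r a) = ψ v) :
    ∃ m : Measure Γ.InfPath, (∀ a, m (Γ.arrowCylinder a) = w a * ψ (Γ.r a)) ∧
      ∀ n x, m (cylinder n x) =
        (∏ i ∈ Finset.range (n + 1), (w (x.1 i) : ℝ≥0∞)) * ψ (Γ.r (x.1 n)) := by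
  let _ : MeasurableSpace A := ⊤
  have : MeasurableSingletonClass A := ⟨fun _ => trivial⟩
  have := isMarkovKernel_arrowKernel hrow hpos hψ
  let μ := chainMeasure (fun a => w a * ψ (Γ.r a)) (arrowKernel hrow w ψ)
  have hμ : μ Γ.pathSetᶜ = 0 :=
    chainMeasure_compl_pathSet _ _ fun a b => arrowKernel_singleton_eq_zero hrow w ψ
  let m : Measure Γ.InfPath := μ.comap fun p => p.1
  have hm : ∀ n (x : ℕ → A), m {p | ∀ i ≤ n, p.1 i = x i} = μ {y | ∀ i ≤ n, y i = x i} := by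
    intro n x
    have hms : MeasurableSet {p : Γ.InfPath | ∀ i ≤ n, p.1 i = x i} := by
      have : {p : Γ.InfPath | ∀ i ≤ n, p.1 i = x i} =
          ⋂ i ∈ Set.Iic n, {p : Γ.InfPath | p.1 i ∈ ({x i} : Set A)} := by
        ext p
        simp
      rw [this]
      exact MeasurableSet.biInter (Set.to_countable _) fun i _ => measurableSet_arrow_mem i _
    have himage : (fun p : Γ.InfPath => p.1) '' {p : Γ.InfPath | ∀ i ≤ n, p.1 i = x i} =
        {y | ∀ i ≤ n, y i = x i} ∩ Γ.pathSet := by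
      have hrange : Set.range (fun p : Γ.InfPath => p.1) = Γ.pathSet := Subtype.range_coe
      rw [← hrange, ← Set.image_preimage_eq_inter_range]
      rfl
    rw [← measure_inter_conull (t := Γ.pathSet) hμ,
      ← himage]
    exact Measure.comap_apply _ injective_val (fun s hs => measurableSet_val_image hs) _ hms
  refine ⟨m, fun a => ?_, fun n x => ?_⟩
  · have h1 : Γ.arrowCylinder a = {p : Γ.InfPath | ∀ i ≤ 0, p.1 i = (fun _ => a) i} := by
      ext p
      simp [arrowCylinder]
    rw [h1, hm, chainMeasure_zero]
    push_cast
    rfl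
  · rw [cylinder, hm]
    induction n with
    | zero =>
      rw [chainMeasure_zero]
      simp
    | succ n ih =>
      have h1 : w (x.1 (n + 1)) * ψ (Γ.r (x.1 (n + 1))) / ψ (Γ.r (x.1 n)) * ψ (Γ.r (x.1 n)) =
          w (x.1 (n + 1)) * ψ (Γ.r (x.1 (n + 1))) := div_mul_cancel₀ _ (hpos _).ne'
      rw [chainMeasure_succ, ih, arrowKernel_singleton hrow w ψ (x.2 n), mul_left_comm,
        ← ENNReal.coe_mul, h1, Finset.prod_range_succ _ (n + 1), ENNReal.coe_mul, mul_assoc]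

/-- Every positive harmonic function comes from a conformal measure. -/
theorem exists_isConformal [Countable A] [Nonempty V] (hrow : Γ.RowFinite) (F : A → ℝ) (β : ℝ)
    {ψ : V → ℝ≥0} (hpos : ∀ v, 0 < ψ v)
    (hψ : ∀ v, ∑ a ∈ outArrows hrow v, weight F β a * ψ (Γ.r a) = ψ v) :
    ∃ m : Measure Γ.InfPath, Γ.IsConformal F β m ∧ ∀ v, m (Γ.vertexCylinder v) = ψ v := by
  obtain ⟨m, hm0, hm⟩ := exists_measure_cylinder hrow hpos hψ
  have hmv : ∀ v, m (Γ.vertexCylinder v) = ψ v := by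
    intro v
    have : Γ.vertexCylinder v = ⋃ a ∈ outArrows hrow v, Γ.arrowCylinder a := by
      ext p
      simp [vertexCylinder, arrowCylinder, InfPath.vertex]
    rw [this, measure_biUnion_finset, ← hψ v]
    · simp [hm0]
    · intro a _ b _ hab
      exact Set.disjoint_left.2 fun p hp hq => hab ((Eq.symm hp).trans hq)
    · exact fun a _ => measurableSet_arrowCylinder a
  refine ⟨m, ⟨?_, fun v => by simp [hmv], fun a B hB => ?_⟩, hmv⟩
  · rintro rfl
    obtain ⟨v⟩ := ‹Nonempty V›
    simpa [(hpos v).ne] using hmv v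
  have key : (m.restrict (Γ.arrowCylinder a)).map Γ.shift =
      weight F β a • m.restrict (Γ.vertexCylinder (Γ.r a)) := by
    refine ext_of_cylinders (fun v => ?_) fun n x => ?_
    · refine ne_top_of_le_ne_top (b := m (Γ.vertexCylinder (Γ.s a))) (by simp [hmv]) ?_
      rw [Measure.map_apply measurable_shift (measurableSet_vertexCylinder v),
        Measure.restrict_apply' (measurableSet_arrowCylinder a)]
      exact measure_mono fun p hp => congrArg Γ.s hp.2
    · rw [Measure.map_apply measurable_shift (measurableSet_cylinder n x),
        Measure.restrict_apply' (measurableSet_arrowCylinder a), Measure.smul_apply,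
        Measure.restrict_apply' (measurableSet_vertexCylinder _), ENNReal.smul_def, smul_eq_mul]
      by_cases hax : Γ.r a = x.vertex 0
      · have h1 := cylinder_succ n (.cons a x hax)
        rw [shift_cons] at h1
        have hsub : cylinder n x ⊆ Γ.vertexCylinder (Γ.r a) := by
          rw [hax]
          exact cylinder_subset_vertexCylinder n x
        rw [Set.inter_eq_left.2 hsub, Set.inter_comm]
        refine (congrArg m h1).symm.trans ?_
        rw [hm, hm, Finset.prod_range_succ', ← mul_assoc, mul_comm (weight F β a : ℝ≥0∞)]
        rfl
      · have h1 : Γ.shift ⁻¹' cylinder n x ∩ Γ.arrowCylinder a = ∅ := by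
          refine Set.eq_empty_of_forall_notMem fun p hp => hax ?_
          have h2 := cylinder_subset_vertexCylinder n x hp.1
          exact (Eq.symm (shift_mem_vertexCylinder hp.2)).trans h2
        have h2 : cylinder n x ∩ Γ.vertexCylinder (Γ.r a) = ∅ := by
          refine Set.eq_empty_of_forall_notMem fun p hp => hax ?_
          exact (Eq.symm hp.2).trans (cylinder_subset_vertexCylinder n x hp.1)
        rw [h1, h2, measure_empty, mul_zero]
  have hD := measurableSet_shift_image a hB
  have h1 := congrArg (fun μ => μ (Γ.shift '' (B ∩ Γ.arrowCylinder a))) key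
  simp only [Measure.map_apply measurable_shift hD,
    Measure.restrict_apply' (measurableSet_arrowCylinder a), Measure.smul_apply,
    Measure.restrict_apply' (measurableSet_vertexCylinder _), ENNReal.smul_def, smul_eq_mul] at h1
  have h2 : Γ.shift ⁻¹' (Γ.shift '' (B ∩ Γ.arrowCylinder a)) ∩ Γ.arrowCylinder a =
      B ∩ Γ.arrowCylinder a := by
    ext p
    constructor
    · rintro ⟨⟨q, hq, hqp⟩, hp⟩
      exact injOn_shift a hq.2 hp hqp ▸ hq
    · exact fun hp => ⟨⟨p, hp, rfl⟩, hp.2⟩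
  have h3 : Γ.shift '' (B ∩ Γ.arrowCylinder a) ∩ Γ.vertexCylinder (Γ.r a) =
      Γ.shift '' (B ∩ Γ.arrowCylinder a) := by
    refine Set.inter_eq_left.2 ?_
    rintro _ ⟨p, hp, rfl⟩
    exact shift_mem_vertexCylinder hp.2
  rw [h2, h3] at h1
  rw [h1, ← mul_assoc, ofReal_exp_mul_weight, one_mul]

/-! ### Harmonic functions with prescribed boundary behaviour -/

open Filter Topology

/-- The real functions `ψ` on the vertices that are harmonic for the weights `w` and such that, for
every finite set `K`, the values of `ψ` on `D K` are the averages of its values at the first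
exit from `D K`. -/
noncomputable def boundarySpace (hrow : Γ.RowFinite) (w : A → ℝ≥0) (D : Finset V → Set V) :
    Submodule ℝ (V → ℝ) where
  carrier := {ψ | (∀ v, ∑ a ∈ outArrows hrow v, w a * ψ (Γ.r a) = ψ v) ∧
    ∀ K, ∀ v ∈ D K, ∑ k ∈ K, (green hrow w (D K) k v).toReal * ψ k = ψ v}
  zero_mem' := by simp
  add_mem' := by
    rintro f g ⟨hf, hf'⟩ ⟨hg, hg'⟩
    refine ⟨fun v => ?_, fun K v hv => ?_⟩
    · simp only [Pi.add_apply, mul_add, Finset.sum_add_distrib, hf, hg]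
    · simp only [Pi.add_apply, mul_add, Finset.sum_add_distrib, hf' K v hv, hg' K v hv]
  smul_mem' := by
    rintro c f ⟨hf, hf'⟩
    refine ⟨fun v => ?_, fun K v hv => ?_⟩
    · simp only [Pi.smul_apply, smul_eq_mul, mul_left_comm _ c, ← Finset.mul_sum, hf]
    · simp only [Pi.smul_apply, smul_eq_mul, mul_left_comm _ c, ← Finset.mul_sum, hf' K v hv]

/-- The non-negative elements of `boundarySpace` with the value `1` at the base point `o`. -/
def normalizedBoundary (hrow : Γ.RowFinite) (w : A → ℝ≥0) (D : Finset V → Set V) (o : V) :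
    Set (V → ℝ) :=
  {ψ | (∀ v, 0 ≤ ψ v) ∧ ψ o = 1 ∧ ψ ∈ boundarySpace hrow w D}

variable (hrow : Γ.RowFinite) {w : A → ℝ≥0} {D : Finset V → Set V}

theorem step_ofReal {ψ : V → ℝ} (h0 : ∀ v, 0 ≤ ψ v) (v : V) :
    step hrow w Set.univ (fun u => ENNReal.ofReal (ψ u)) v =
      ENNReal.ofReal (∑ a ∈ outArrows hrow v, w a * ψ (Γ.r a)) := by
  rw [step_univ_apply, ENNReal.ofReal_sum_of_nonneg fun a _ => mul_nonneg (w a).coe_nonneg (h0 _)]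
  refine Finset.sum_congr rfl fun a _ => ?_
  rw [ENNReal.ofReal_mul (w a).coe_nonneg, ENNReal.ofReal_coe_nnreal]

theorem harnack_real (hconn : Γ.StronglyConnected) (hw : ∀ a, 0 < w a) (v u : V) :
    ∃ c : ℝ, 0 < c ∧ ∀ ψ ∈ boundarySpace hrow w D, (∀ v, 0 ≤ ψ v) → c * ψ u ≤ ψ v := by
  obtain ⟨c, hc, h⟩ := harnack hrow w hconn hw v u
  refine ⟨c, hc, fun ψ hψ h0 => ?_⟩
  have h1 := h (fun u => ENNReal.ofReal (ψ u)) fun x => by rw [step_ofReal hrow h0, hψ.1 x]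
  rwa [← ENNReal.ofReal_coe_nnreal, ← ENNReal.ofReal_mul c.coe_nonneg,
    ENNReal.ofReal_le_ofReal_iff (h0 v)] at h1

theorem eq_zero_of_apply_eq_zero (hconn : Γ.StronglyConnected) (hw : ∀ a, 0 < w a) {ψ : V → ℝ}
    (hψ : ψ ∈ boundarySpace hrow w D) (h0 : ∀ v, 0 ≤ ψ v) {o : V} (ho : ψ o = 0) : ψ = 0 := by
  ext v
  obtain ⟨c, hc, h⟩ := harnack_real (D := D) hrow hconn hw o v
  have := h ψ hψ h0
  rw [ho] at this
  exact le_antisymm (nonpos_of_mul_nonpos_right this hc) (h0 v)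

theorem isCompact_normalizedBoundary (hconn : Γ.StronglyConnected) (hw : ∀ a, 0 < w a) (o : V) :
    IsCompact (normalizedBoundary hrow w D o) := by
  choose c hc h using fun v => harnack_real (D := D) hrow hconn hw o v
  refine (isCompact_univ_pi fun v => isCompact_Icc (a := (0 : ℝ)) (b := (c v)⁻¹)).of_isClosed_subset
    ?_ ?_
  · have h1 : IsClosed (boundarySpace hrow w D : Set (V → ℝ)) := by
      have : (boundarySpace hrow w D : Set (V → ℝ)) =
          (⋂ v, {ψ : V → ℝ | ∑ a ∈ outArrows hrow v, (w a : ℝ) * ψ (Γ.r a) = ψ v}) ∩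
          ⋂ K, ⋂ v ∈ D K, {ψ | ∑ k ∈ K, (green hrow w (D K) k v).toReal * ψ k = ψ v} := by
        ext ψ
        simp [boundarySpace]
      rw [this]
      refine (isClosed_iInter fun v => ?_).inter
        (isClosed_iInter fun K => isClosed_iInter fun v => isClosed_iInter fun _ => ?_)
      · exact isClosed_eq (by fun_prop) (by fun_prop)
      · exact isClosed_eq (by fun_prop) (by fun_prop)
    have h2 : IsClosed {ψ : V → ℝ | ∀ v, 0 ≤ ψ v} := isClosed_Ici (a := (0 : V → ℝ))
    have h3 : IsClosed {ψ : V → ℝ | ψ o = 1} := isClosed_eq (by fun_prop) (by fun_prop)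
    exact h2.inter (h3.inter h1)
  · rintro ψ ⟨h0, ho, hψ⟩ v -
    refine ⟨h0 v, ?_⟩
    have := h v ψ hψ h0
    rwa [ho, mul_comm, ← le_div_iff₀ (hc v), one_div] at this

theorem toReal_eq_sum {ι : Type*} {s : Finset ι} {x : ℝ≥0∞} {c f : ι → ℝ≥0∞}
    (hc : ∀ i, c i ≠ ∞) (hf : ∀ i, f i ≠ ∞) (h : x = ∑ i ∈ s, c i * f i) :
    ∑ i ∈ s, (c i).toReal * (f i).toReal = x.toReal := by
  rw [h, ENNReal.toReal_sum fun i _ => ENNReal.mul_ne_top (hc i) (hf i)]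
  exact Finset.sum_congr rfl fun i _ => ENNReal.toReal_mul.symm

theorem sum_eq_of_tendsto_div {ι : Type*} {l : Filter ℕ} [l.NeBot] {g : ℕ → V → ℝ} {d : ℕ → ℝ}
    {ψ : V → ℝ} (hlim : ∀ v, Tendsto (fun n => g n v / d n) l (𝓝 (ψ v))) {s : Finset ι}
    {b : ι → ℝ} {e : ι → V} {v : V} (hev : ∀ᶠ n in l, ∑ i ∈ s, b i * g n (e i) = g n v) :
    ∑ i ∈ s, b i * ψ (e i) = ψ v := by
  refine tendsto_nhds_unique_of_eventuallyEq
    (tendsto_finsetSum s fun i _ => (hlim (e i)).const_mul (b i)) (hlim v) ?_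
  filter_upwards [hev] with n hn
  simp only [← hn, Finset.sum_div, mul_div_assoc]

/-- A limit of normalized Green functions with poles that leave all the sets `D K`. -/
theorem normalizedBoundary_nonempty (hconn : Γ.StronglyConnected) (hw : ∀ a, 0 < w a)
    (hfin : ∀ x v, green hrow w Set.univ x v ≠ ∞) (hK : ∀ K, ∀ k ∈ K, k ∉ D K)
    (hDK : ∀ K a, Γ.s a ∈ D K → Γ.r a ∈ D K ∨ Γ.r a ∈ K) (o : V) {x : ℕ → V}
    (hx : ∀ v, ∀ᶠ n in atTop, x n ≠ v) (hxD : ∀ K, ∀ᶠ n in atTop, x n ∉ D K) :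
    (normalizedBoundary hrow w D o).Nonempty := by
  let G : ℕ → V → ℝ≥0∞ := fun n v => green hrow w Set.univ (x n) v
  have hG0 : ∀ n v, 0 < (G n v).toReal := fun n v =>
    ENNReal.toReal_pos (green_univ_ne_zero hrow w hconn hw _ _) (hfin _ _)
  let k : ℕ → V → ℝ := fun n v => (G n v).toReal / (G n o).toReal
  choose c hc h using fun v => harnack hrow w hconn hw o v
  have hbox : ∀ n, k n ∈ Set.univ.pi fun v => Set.Icc (0 : ℝ) ((c v : ℝ)⁻¹) := by
    intro n v _
    refine ⟨div_nonneg (hG0 n v).le (hG0 n o).le, ?_⟩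
    have h1 := ENNReal.toReal_mono (hfin _ _) (h v _ (step_green_univ_le hrow w (x n)))
    rw [ENNReal.toReal_mul, ENNReal.coe_toReal] at h1
    rw [div_le_iff₀ (hG0 n o), ← div_eq_inv_mul, le_div_iff₀ (NNReal.coe_pos.2 (hc v)), mul_comm]
    exact h1
  obtain ⟨ψ, hψ, hlim⟩ := isCompact_iff_ultrafilter_le_nhds.1
    (isCompact_univ_pi fun v => isCompact_Icc (a := (0 : ℝ)) (b := (c v : ℝ)⁻¹))
    ((hyperfilter ℕ).map k) (by
      rw [Ultrafilter.coe_map, le_principal_iff, mem_map]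
      exact Filter.univ_mem' hbox)
  have hlim' : ∀ v, Tendsto (fun n => k n v) (hyperfilter ℕ) (𝓝 (ψ v)) := fun v =>
    tendsto_pi_nhds.1 (show Tendsto k (hyperfilter ℕ) (𝓝 ψ) from hlim) v
  have hat : (hyperfilter ℕ : Filter ℕ) ≤ atTop := Nat.hyperfilter_le_atTop
  refine ⟨ψ, fun v => (hψ v trivial).1, ?_, fun v => ?_, fun K v hv => ?_⟩
  · refine tendsto_nhds_unique (hlim' o) ?_
    have : ∀ n, k n o = 1 := fun n => div_self (hG0 n o).ne'
    simp [this]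
  · refine sum_eq_of_tendsto_div hlim' ?_
    filter_upwards [hat (hx v)] with n hn
    refine toReal_eq_sum (c := fun a => w a) (fun _ => ENNReal.coe_ne_top) (fun _ => hfin _ _) ?_
    rw [← step_univ_apply hrow w (G n)]
    exact green_univ_eq_step hrow w hn.symm
  · refine sum_eq_of_tendsto_div hlim' (e := fun k => k) ?_
    filter_upwards [hat (hxD K)] with n hn
    refine toReal_eq_sum (fun i => ne_top_of_le_ne_top (hfin _ _) (green_le_green_univ hrow w _ _ _))
      (fun _ => hfin _ _) ?_
    exact green_univ_eq_sum_exit hrow w (hK K) (hDK K) hn (hfin _) hv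

section Conformal

variable {F : A → ℝ} {β : ℝ}

theorem IsConformal.mem_boundarySpace {m : Measure Γ.InfPath} (h : Γ.IsConformal F β m)
    (hfin : ∀ x v, green hrow (weight F β) Set.univ x v ≠ ∞) (hK : ∀ K, ∀ k ∈ K, k ∉ D K)
    (hDK : ∀ K a, Γ.s a ∈ D K → Γ.r a ∈ D K ∨ Γ.r a ∈ K)
    (hm : ∀ K, ∀ v ∈ D K, m (Γ.vertexCylinder v ∩ Γ.staysIn (D K)) = 0) :
    (fun v => (m (Γ.vertexCylinder v)).toReal) ∈ boundarySpace hrow (weight F β) D := by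
  refine ⟨fun v => ?_, fun K v hv => ?_⟩
  · refine toReal_eq_sum (c := fun a => weight F β a) (fun _ => ENNReal.coe_ne_top)
      (fun _ => (h.regular _).ne) ?_
    rw [h.harmonic hrow v, step_univ_apply]
  · refine toReal_eq_sum
      (fun i => ne_top_of_le_ne_top (hfin _ _) (green_le_green_univ hrow _ _ _ _))
      (fun _ => (h.regular _).ne) ?_
    rw [h.measure_vertexCylinder_eq hrow (hK K) (hDK K) hv, hm K v hv, add_zero]

/-- Conversely, the conformal measure of an element of `boundarySpace` charges no set of paths that
stay in `D K`. -/
theorem IsConformal.measure_staysIn_eq_zero {m : Measure Γ.InfPath} (h : Γ.IsConformal F β m)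
    (hfin : ∀ x v, green hrow (weight F β) Set.univ x v ≠ ∞) (hK : ∀ K, ∀ k ∈ K, k ∉ D K)
    (hDK : ∀ K a, Γ.s a ∈ D K → Γ.r a ∈ D K ∨ Γ.r a ∈ K)
    (hm : (fun v => (m (Γ.vertexCylinder v)).toReal) ∈ boundarySpace hrow (weight F β) D)
    (K : Finset V) {v : V} (hv : v ∈ D K) :
    m (Γ.vertexCylinder v ∩ Γ.staysIn (D K)) = 0 := by
  have hgreen : ∀ k, green hrow (weight F β) (D K) k v ≠ ∞ := fun k =>
    ne_top_of_le_ne_top (hfin _ _) (green_le_green_univ hrow _ _ _ _)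
  have hsum : ∑ k ∈ K, green hrow (weight F β) (D K) k v * m (Γ.vertexCylinder k) ≠ ∞ :=
    ENNReal.sum_ne_top.2 fun k _ => ENNReal.mul_ne_top (hgreen k) (h.regular k).ne
  have h1 := h.measure_vertexCylinder_eq hrow (hK K) (hDK K) hv
  have h2 : ∑ k ∈ K, green hrow (weight F β) (D K) k v * m (Γ.vertexCylinder k) =
      m (Γ.vertexCylinder v) := by
    rw [← ENNReal.toReal_eq_toReal_iff' hsum (h.regular v).ne]
    exact (toReal_eq_sum hgreen (fun k => (h.regular k).ne) rfl).symm.trans (hm.2 K v hv)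
  rw [← h2] at h1
  nth_rw 1 [← add_zero (∑ k ∈ K, _)] at h1
  exact ((ENNReal.add_right_inj hsum).1 h1).symm

theorem exists_isExtremalConformal [Countable V] [Countable A] (hconn : Γ.StronglyConnected)
    (hfin : ∀ x v, green hrow (weight F β) Set.univ x v ≠ ∞) (hK : ∀ K, ∀ k ∈ K, k ∉ D K)
    (hDK : ∀ K a, Γ.s a ∈ D K → Γ.r a ∈ D K ∨ Γ.r a ∈ K) {x : ℕ → V}
    (hx : ∀ v, ∀ᶠ n in atTop, x n ≠ v) (hxD : ∀ K, ∀ᶠ n in atTop, x n ∉ D K) :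
    ∃ m, Γ.IsExtremalConformal F β m ∧
      ∀ K, ∀ v ∈ D K, m (Γ.vertexCylinder v ∩ Γ.staysIn (D K)) = 0 := by
  have hw := weight_pos F β
  let o := x 0
  have : Nonempty V := ⟨o⟩
  obtain ⟨ψ, hψ⟩ := (isCompact_normalizedBoundary (D := D) hrow hconn hw o).extremePoints_nonempty
    (normalizedBoundary_nonempty hrow hconn hw hfin hK hDK o hx hxD)
  obtain ⟨⟨h0, ho, hmem⟩, hext⟩ := mem_extremePoints.1 hψ
  have hpos : ∀ v, 0 < ψ v := by
    intro v
    obtain ⟨c, hc, h⟩ := harnack_real (D := D) hrow hconn hw v o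
    have := h ψ hmem h0
    rw [ho, mul_one] at this
    exact hc.trans_le this
  obtain ⟨m, hm, hmψ⟩ := exists_isConformal (ψ := fun v => (ψ v).toNNReal) hrow F β
    (fun v => Real.toNNReal_pos.2 (hpos v)) fun v => by
      apply NNReal.coe_injective
      push_cast
      simp only [Real.coe_toNNReal _ (h0 _)]
      exact hmem.1 v
  have hmψ' : (fun v => (m (Γ.vertexCylinder v)).toReal) = ψ := by
    ext v
    rw [hmψ, ENNReal.coe_toReal, Real.coe_toNNReal _ (h0 v)]
  have hstay : ∀ K, ∀ v ∈ D K, m (Γ.vertexCylinder v ∩ Γ.staysIn (D K)) = 0 := fun K v hv =>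
    hm.measure_staysIn_eq_zero hrow hfin hK hDK (by rwa [hmψ']) K hv
  refine ⟨m, ⟨hm, fun m' hm' hle => ?_⟩, hstay⟩
  set φ : V → ℝ := fun v => (m' (Γ.vertexCylinder v)).toReal with hφ
  have hφmem : φ ∈ boundarySpace hrow (weight F β) D :=
    hm'.mem_boundarySpace hrow hfin hK hDK fun K v hv =>
      le_antisymm ((hle _).trans (hstay K v hv).le) zero_le
  have hφ0 : ∀ v, 0 ≤ φ v := fun v => ENNReal.toReal_nonneg
  have hφψ : ∀ v, φ v ≤ ψ v := fun v => by
    rw [← hmψ']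
    exact ENNReal.toReal_mono (hm.regular v).ne (hle _)
  have ht0 : 0 < φ o := by
    refine (hφ0 o).lt_of_ne' fun h => hm'.ne_zero ?_
    have hz := eq_zero_of_apply_eq_zero hrow hconn hw hφmem hφ0 h
    refine Measure.measure_univ_eq_zero.1 (measure_eq_zero_of_forall_vertexCylinder fun v => ?_)
    rw [Set.inter_univ]
    exact ((ENNReal.toReal_eq_zero_iff _).1 (congrFun hz v)).resolve_right (hm'.regular v).ne
  have hsub0 : ∀ v, 0 ≤ (ψ - φ) v := fun v => sub_nonneg.2 (hφψ v)
  have hsubmem := (boundarySpace hrow (weight F β) D).sub_mem hmem hφmem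
  have hφeq : φ = φ o • ψ := by
    rcases (ho ▸ hφψ o : φ o ≤ 1).eq_or_lt with h1 | h1
    · have hz := eq_zero_of_apply_eq_zero hrow hconn hw hsubmem hsub0 (o := o)
        (by simp [ho, h1])
      rw [h1, one_smul]
      exact (sub_eq_zero.1 hz).symm
    · have hs : 0 < 1 - φ o := sub_pos.2 h1
      have hφ1 : (φ o)⁻¹ • φ ∈ normalizedBoundary hrow (weight F β) D o :=
        ⟨fun v => mul_nonneg (inv_nonneg.2 ht0.le) (hφ0 v), inv_mul_cancel₀ ht0.ne',
          Submodule.smul_mem _ _ hφmem⟩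
      have hφ2 : (1 - φ o)⁻¹ • (ψ - φ) ∈ normalizedBoundary hrow (weight F β) D o := by
        refine ⟨fun v => mul_nonneg (inv_nonneg.2 hs.le) (hsub0 v), ?_,
          Submodule.smul_mem _ _ hsubmem⟩
        rw [Pi.smul_apply, Pi.sub_apply, ho, smul_eq_mul, inv_mul_cancel₀ hs.ne']
      have h2 := hext _ hφ1 _ hφ2 ⟨φ o, 1 - φ o, ht0, hs, by ring, by
        rw [smul_smul, smul_smul, mul_inv_cancel₀ ht0.ne', mul_inv_cancel₀ hs.ne', one_smul,
          one_smul, add_sub_cancel]⟩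
      rw [← h2.1, smul_smul, mul_inv_cancel₀ ht0.ne', one_smul]
  refine ⟨(φ o).toNNReal, Real.toNNReal_pos.2 ht0, hm.eq_smul hm' fun v => ?_⟩
  rw [hmψ, ← ENNReal.coe_mul, ← Real.toNNReal_mul ht0.le]
  have h3 := congrFun hφeq v
  rw [Pi.smul_apply, smul_eq_mul] at h3
  rw [← h3]
  exact (ENNReal.ofReal_toReal (hm'.regular v).ne).symm

end Conformal

/-! ### The measures of an end -/

/-- The vertices outside of `K` from which the tail of `p` cannot be reached outside of `K`. -/
def cutOff (p : Γ.InfPath) (K : Finset V) : Set V :=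
  {u | u ∉ K ∧ ¬ ∃ᶠ n in atTop, Γ.ReachAvoiding K u (p.vertex n)}

theorem range_mem_cutOff_or (p : Γ.InfPath) (K : Finset V) (a : A) (ha : Γ.s a ∈ cutOff p K) :
    Γ.r a ∈ cutOff p K ∨ Γ.r a ∈ K := by
  by_cases hK : Γ.r a ∈ K
  · exact Or.inr hK
  · exact Or.inl ⟨hK, fun h => ha.2 (h.mono fun n hn => .cons ha.1 hn)⟩

theorem InfPath.IsWandering.eventually_notMem {p : Γ.InfPath} (hp : p.IsWandering)
    (K : Finset V) : ∀ᶠ n in atTop, p.vertex n ∉ K := by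
  obtain ⟨N, hN⟩ := hp K
  exact eventually_atTop.2 ⟨N, hN⟩

theorem InfPath.IsWandering.eventually_notMem_cutOff {p : Γ.InfPath} (hp : p.IsWandering)
    (K : Finset V) : ∀ᶠ n in atTop, p.vertex n ∉ cutOff p K := by
  obtain ⟨N, hN⟩ := hp K
  refine eventually_atTop.2 ⟨N, fun n hn h => h.2 ?_⟩
  refine (eventually_atTop.2 ⟨n, fun k hk => ?_⟩).frequently
  exact .along p hk fun i hi => hN i (hn.trans hi)

theorem leads_of_frequently_notMem_cutOff {p q : Γ.Wan}
    (h : ∀ K, ∃ᶠ n in atTop, q.1.vertex n ∉ cutOff p.1 K) : Γ.Leads q p := by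
  intro K N
  obtain ⟨n, hn, h1, h2⟩ :=
    frequently_atTop.1 ((h K).and_eventually (q.2.eventually_notMem K)) N
  have h3 : ∃ᶠ k in atTop, Γ.ReachAvoiding K (q.1.vertex n) (p.1.vertex k) := by
    by_contra h4
    exact h1 ⟨h2, h4⟩
  obtain ⟨k, hk, h4⟩ := frequently_atTop.1 h3 N
  exact ⟨n, hn, k, hk, h4⟩

theorem exists_isExtremalConformal_concentratedOn [Countable V] [Countable A]
    (hrow : Γ.RowFinite) (hconn : Γ.StronglyConnected) (hund : Γ.AlmostUndirected)
    {F : A → ℝ} {β : ℝ} (hfin : ∀ x v, green hrow (weight F β) Set.univ x v ≠ ∞)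
    (E : Γ.EndSpace) : ∃ m, Γ.IsExtremalConformal F β m ∧ Γ.ConcentratedOn m E := by
  obtain ⟨p, rfl⟩ := Quotient.exists_rep E
  obtain ⟨m, hm, hstay⟩ := exists_isExtremalConformal (F := F) (β := β) (D := cutOff p.1) hrow
    hconn hfin (fun K k hk h => h.1 hk) (range_mem_cutOff_or p.1) (x := p.1.vertex)
    (fun v => by simpa using p.2.eventually_notMem {v}) p.2.eventually_notMem_cutOff
  refine ⟨m, hm, ?_⟩
  have h1 := ae_all_iff.2 fun K => hm.isConformal.ae_frequently_notMem hrow (hstay K)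
  change ∀ᵐ q ∂m, q ∈ EndSpace.carrier _
  filter_upwards [hm.isConformal.ae_isWandering hrow hfin, h1] with q hq hq'
  have h2 : Γ.Leads ⟨q, hq⟩ p := leads_of_frequently_notMem_cutOff hq'
  exact ⟨hq, Quotient.sound ⟨h2, h2.symm hrow hund⟩⟩

end DirGraph

open DirGraph in
theorem theorem8p25 {V A : Type*} [Countable V] [Countable A] (Γ : DirGraph V A)
    (hrow : Γ.RowFinite) (hconn : Γ.StronglyConnected) (hund : Γ.AlmostUndirected)
    (F : A → ℝ) (β : ℝ) (htrans : Γ.Transient F β) :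
    ∃ Λ : {m : MeasureTheory.Measure Γ.InfPath // Γ.IsExtremalConformal F β m} → Γ.EndSpace,
      (∀ m E, Λ m = E ↔ Γ.ConcentratedOn m.1 E) ∧ Function.Surjective Λ := by
  have hfin := htrans.green_ne_top hrow hconn
  choose Λ hΛ using fun m : {m : Measure Γ.InfPath // Γ.IsExtremalConformal F β m} =>
    m.2.exists_concentratedOn (m.2.isConformal.ae_isWandering hrow hfin)
  have h : ∀ m E, Λ m = E ↔ Γ.ConcentratedOn m.1 E := fun m E =>
    ⟨fun h => h ▸ hΛ m, (hΛ m).unique m.2.isConformal.ne_zero⟩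
  refine ⟨Λ, h, fun E => ?_⟩
  obtain ⟨m, hm, hE⟩ := exists_isExtremalConformal_concentratedOn hrow hconn hund hfin E
  exact ⟨⟨m, hm⟩, (h _ E).2 hE⟩
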